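/- Let $\mathrm{SL}_2(\mathbb Z)\backslash \mathrm{SL}_2(\mathbb R)$ be the space of unimodular lattices in $\mathbb R^2$, the coset $\mathrm{SL}_2(\mathbb Z)g$ corresponding to the lattice $\Lambda=\mathbb Z^2 g$, and let $\mu$ be the probability measure on it coming from Haar measure of $\mathrm{SL}_2(\mathbb R)$. For a unimodular lattice $\Lambda$ and $T>0$ let $\mathcal N_\Lambda(T)$ be the number of points of $\Lambda$ of Euclidean norm less than $T$, and let $\mathcal R_\Lambda(T)=\mathcal N_\Lambda(T)-\pi T^2$. Then $\mu$ is indeed a probability measure (the Haar measure of a fundamental domain is finite and positive), and for every compact set $K\subset \mathrm{SL}_2(\mathbb Z)\backslash \mathrm{SL}_2(\mathbb R)$ there is a constant $C>0$ depending only on $K$ such that for all $T\ge 2$ the function $\Lambda\mapsto|\mathcal R_\Lambda(T)|^2$ is $\mu$-integrable on $K$ and $$\int_K |\mathcal R_\Lambda(T)|^2\,d\mu(\Lambda)\le C\,T\log^2(T).$$ -/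

import Mathlib

open Matrix MeasureTheory
open scoped MatrixGroups

noncomputable section

namespace UnimodularLattice

/-- The Borel σ-algebra on `SL₂(ℝ)`. -/
instance instMeasurableSpaceSL2R : MeasurableSpace SL(2, ℝ) := borel _

instance instBorelSpaceSL2R : BorelSpace SL(2, ℝ) := ⟨rfl⟩

instance instLocallyCompactSpaceSL2R : LocallyCompactSpace SL(2, ℝ) :=
  have : LocallyCompactSpace (Matrix (Fin 2) (Fin 2) ℝ) :=
    inferInstanceAs (LocallyCompactSpace (Fin 2 → Fin 2 → ℝ))
  (SpecialLinearGroup.isClosedEmbedding_val (n := Fin 2) (R := ℝ)).locallyCompactSpace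

/-- `SL₂(ℤ)` as a subgroup of `SL₂(ℝ)`. -/
def Gam : Subgroup SL(2, ℝ) :=
  (SpecialLinearGroup.map (n := Fin 2) (Int.castRingHom ℝ)).range

/-- The space of unimodular lattices `SL₂(ℤ) \ SL₂(ℝ)`: the set of cosets `SL₂(ℤ) g`. -/
def LatticeSpace : Type := Quotient (QuotientGroup.rightRel Gam)

/-- The coset `SL₂(ℤ) g` of `g`. -/
def proj (g : SL(2, ℝ)) : LatticeSpace := Quotient.mk (QuotientGroup.rightRel Gam) g

/-- The quotient topology. -/
instance instTopologicalSpaceLatticeSpace : TopologicalSpace LatticeSpace :=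
  inferInstanceAs (TopologicalSpace (Quotient (QuotientGroup.rightRel Gam)))

/-- The Borel σ-algebra of the quotient topology. -/
instance instMeasurableSpaceLatticeSpace : MeasurableSpace LatticeSpace := borel _

instance instBorelSpaceLatticeSpace : BorelSpace LatticeSpace := ⟨rfl⟩

/-- The lattice `ℤ² g ⊆ ℝ²` spanned by the rows of `g`, in the Euclidean plane. -/
def rowLattice (g : SL(2, ℝ)) : Set (EuclideanSpace ℝ (Fin 2)) :=
  Set.range fun m : Fin 2 → ℤ =>
    WithLp.toLp 2 ((fun i => (m i : ℝ)) ᵥ* (g : Matrix (Fin 2) (Fin 2) ℝ))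

theorem rowLattice_mul_subset (γ : SL(2, ℤ)) (g : SL(2, ℝ)) :
    rowLattice (SpecialLinearGroup.map (Int.castRingHom ℝ) γ * g) ⊆ rowLattice g := by
  rintro _ ⟨m, rfl⟩
  refine ⟨m ᵥ* (γ : Matrix (Fin 2) (Fin 2) ℤ), ?_⟩
  ext j
  fin_cases j <;>
    simp [Matrix.vecMul, dotProduct, Matrix.mul_apply, Fin.sum_univ_two] <;> ring

/-- The subset of `ℝ²` which is the lattice given by a point `SL₂(ℤ) g` of the space of
unimodular lattices, namely `ℤ² g`. -/
def LatticeSpace.toSet (L : LatticeSpace) : Set (EuclideanSpace ℝ (Fin 2)) :=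
  Quotient.lift rowLattice (by
    intro a b h
    obtain ⟨γ, hγ⟩ := QuotientGroup.rightRel_apply.mp h
    have hb : b = SpecialLinearGroup.map (Int.castRingHom ℝ) γ * a := by
      rw [hγ]; group
    have ha : a = SpecialLinearGroup.map (Int.castRingHom ℝ) γ⁻¹ * b := by
      rw [hb, map_inv]; group
    refine Set.Subset.antisymm ?_ ?_
    · conv_lhs => rw [ha]
      exact rowLattice_mul_subset _ _
    · rw [hb]
      exact rowLattice_mul_subset _ _) L

/-- The number of lattice points of Euclidean norm less than `T`. -/
def count (L : LatticeSpace) (T : ℝ) : ℕ := {v ∈ L.toSet | ‖v‖ < T}.ncard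

/-- The remainder in the circle problem for the lattice `L`. -/
def remainder (L : LatticeSpace) (T : ℝ) : ℝ := (count L T : ℝ) - Real.pi * T ^ 2

/-- The lift to `SL₂(ℝ)` of the standard fundamental domain `|z| ≥ 1, |Re z| ≤ 1/2` of the
modular group acting on the upper half plane, along `g ↦ g • i`. It meets every coset
`SL₂(ℤ) g`, and off a Haar-null set it meets each coset in exactly two points `g` and `-g`. -/
def fundamentalSet : Set SL(2, ℝ) := {g | g • UpperHalfPlane.I ∈ ModularGroup.fd}

/-- The probability measure on `SL₂(ℤ) \ SL₂(ℝ)` coming from Haar measure: Haar measure of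
`SL₂(ℝ)`, restricted to the fundamental set, normalized to total mass one, and pushed forward to
the quotient. (The two-to-one overlap `±g` is uniform, so the normalization absorbs it; the
choice of the Haar measure plays no role.) -/
def haarProb : Measure LatticeSpace :=
  Measure.map proj
    ((Measure.haar fundamentalSet)⁻¹ • (Measure.haar : Measure SL(2, ℝ)).restrict fundamentalSet)

end UnimodularLattice

end

/-! Write z = x + iy for g • i. The squared length of a lattice vector is |m₁ + m₀z|²/y, so the
points can be counted along the lines m₀ = b. With A = T/√y, the line b (|b| < A) meets the disc
where |m₁ + bx| < r_b, r_b = y√(A² − b²); it carries 2r_b points, up to the sawtooth terms saw(±bx −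
r_b). The terms 2r_b form a trapezoidal sum for the area of a half-disc, and concavity makes its
error O(√A) (`abs_sum_sqrt_sub_le`). For y in a compact range this costs only O(T) after squaring.

The sawtooth sums are handled on average. Left multiplication by a unipotent matrix replaces x by x
+ t and fixes y, hence every r_b, so along a horocycle the remainder is governed by ∑_b saw(±bt +
α_b) with constant phases. Hermite's identity bounds the correlation of saw(at + α) and saw(bt + β)
by gcd(a,b)²/(4ab), whatever the phases (`abs_integral_saw_mul_saw_le`). Summing over a, b ≤ n gives
n(1 + log n)², which is the source of T log² T.

Left invariance of Haar measure turns horocycle averages into integrals over boxes in (x, y)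
(`setLIntegral_box_le_of_lintegral_unip_mul_le`). Over a compact set of lattices the fundamental set
has bounded height, so it lies in a compact box. The total mass is finite because dyadic pieces of
the cusp have geometrically decreasing measure, which again needs only left invariance. -/

namespace UnimodularLattice

/-! ### Correlations of sawtooth functions -/

/-- The centred sawtooth function. -/
noncomputable def saw (t : ℝ) : ℝ := Int.fract t - 1 / 2

theorem measurable_saw : Measurable saw := measurable_fract.sub_const _

theorem abs_saw_le (t : ℝ) : |saw t| ≤ 1 / 2 := by
  have h0 := Int.fract_nonneg t
  have h1 := Int.fract_lt_one t
  rw [saw, abs_le]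
  constructor <;> linarith

theorem saw_add_nat (t : ℝ) (n : ℕ) : saw (t + n) = saw t := by simp [saw]

/-- Hermite's identity, for the sawtooth function. -/
theorem sum_saw_add_div {c : ℕ} (hc : 0 < c) (t : ℝ) :
    ∑ j ∈ Finset.range c, saw (t + j / c) = saw (c * t) := by
  have hc' : (0 : ℝ) < c := by exact_mod_cast hc
  -- The difference of the two sides has period 1/c, so it suffices to verify the identity on [0,
  -- 1/c), where no fractional part wraps around.
  have hper : Function.Periodic
      (fun t : ℝ => ∑ j ∈ Finset.range c, saw (t + j / c) - saw (c * t)) (1 / c : ℝ) := by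
    intro t
    have h1 : ∑ j ∈ Finset.range c, saw (t + 1 / c + j / c)
        = ∑ j ∈ Finset.range c, saw (t + j / c) := by
      have h2 := Finset.sum_range_succ (fun j : ℕ => saw (t + j / c)) c
      rw [Finset.sum_range_succ'] at h2
      have h3 : saw (t + (c : ℕ) / c) = saw (t + (0 : ℕ) / c) := by
        rw [div_self hc'.ne']
        simpa using saw_add_nat t 1
      rw [h3] at h2
      rw [← add_right_cancel h2]
      refine Finset.sum_congr rfl fun j _ => ?_
      congr 1
      push_cast
      ring
    have h4 : (c : ℝ) * (t + 1 / c) = c * t + (1 : ℕ) := by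
      field_simp
      simp
    simp only [h1]
    rw [h4, saw_add_nat]
  have hsmall : ∀ t : ℝ, 0 ≤ t → c * t < 1 →
      ∑ j ∈ Finset.range c, saw (t + j / c) - saw (c * t) = 0 := by
    intro t ht0 ht1
    have h1 : ∀ j ∈ Finset.range c, saw (t + j / c) = t + j / c - 1 / 2 := by
      intro j hj
      have hj' : (j : ℝ) + 1 ≤ c := by exact_mod_cast Finset.mem_range.mp hj
      rw [saw, Int.fract_eq_self.mpr]
      refine ⟨by positivity, ?_⟩
      rw [← mul_lt_mul_iff_right₀ hc', mul_add, mul_div_cancel₀ _ hc'.ne']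
      linarith
    have h2 : ∀ n : ℕ, ∑ j ∈ Finset.range n, (j : ℝ) = n * (n - 1) / 2 := by
      intro n
      induction n with
      | zero => simp
      | succ n ih => rw [Finset.sum_range_succ, ih]; push_cast; ring
    rw [Finset.sum_congr rfl h1, saw, Int.fract_eq_self.mpr ⟨by positivity, ht1⟩,
      Finset.sum_sub_distrib, Finset.sum_add_distrib, ← Finset.sum_div, h2]
    simp
    field_simp
    ring
  have h := hper.sub_zsmul_eq (x := t) ⌊c * t⌋
  have e : (c : ℝ) * (t - ⌊c * t⌋ • (1 / c : ℝ)) = Int.fract (c * t) := by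
    rw [Int.fract, zsmul_eq_mul]
    field_simp
  beta_reduce at h
  rw [hsmall] at h
  · linarith
  · have := Int.fract_nonneg (c * t)
    rw [← e] at this
    exact nonneg_of_mul_nonneg_right this hc'
  · rw [e]
    exact Int.fract_lt_one _

/-- Multiplication by a permutes the residues modulo c and `saw` has period 1, so this is a
reordering of Hermite's identity. -/
theorem sum_saw_add_mul_div_of_coprime {a c : ℕ} (hc : 0 < c) (hac : a.Coprime c) (t : ℝ) :
    ∑ j ∈ Finset.range c, saw (t + a * j / c) = saw (c * t) := by
  have hc' : (c : ℝ) ≠ 0 := by exact_mod_cast hc.ne'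
  have hinj : Set.InjOn (fun j => a * j % c) (Finset.range c : Set ℕ) := by
    intro i hi j hj hij
    have h : a * i ≡ a * j [MOD c] := hij
    have h' : i ≡ j [MOD c] := Nat.ModEq.cancel_left_of_coprime (by
      rw [Nat.gcd_comm]; exact hac) h
    exact Nat.ModEq.eq_of_lt_of_lt h' (by simpa using hi) (by simpa using hj)
  have himg : (Finset.range c).image (fun j => a * j % c) = Finset.range c := by
    refine Finset.eq_of_subset_of_card_le ?_ ?_
    · intro k hk
      obtain ⟨j, -, rfl⟩ := Finset.mem_image.mp hk
      exact Finset.mem_range.mpr (Nat.mod_lt _ hc)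
    · rw [Finset.card_image_of_injOn hinj]
  rw [← sum_saw_add_div hc t]
  conv_rhs => rw [← himg, Finset.sum_image hinj]
  refine Finset.sum_congr rfl fun j _ => ?_
  have h : ((a * j : ℕ) : ℝ) = ((a * j % c : ℕ) : ℝ) + c * ((a * j / c : ℕ) : ℝ) := by
    exact_mod_cast (Nat.mod_add_div (a * j) c).symm
  have h2 : t + a * j / c = t + ((a * j % c : ℕ) : ℝ) / c + ((a * j / c : ℕ) : ℝ) := by
    push_cast at h ⊢
    rw [h]
    field_simp
    ring
  rw [h2, saw_add_nat]

/-- In lowest terms a/b = a'/c with b = gc, so the sum runs g times through the coprime case. -/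
theorem sum_saw_add_mul_div (a : ℕ) {b : ℕ} (hb : 0 < b) (t : ℝ) :
    ∑ j ∈ Finset.range b, saw (t + a * j / b) = a.gcd b * saw ((b / a.gcd b : ℕ) * t) := by
  set g := a.gcd b with hg
  have hg0 : 0 < g := Nat.gcd_pos_of_pos_right _ hb
  obtain ⟨a', ha'⟩ := Nat.gcd_dvd_left a b
  obtain ⟨c, hc⟩ := Nat.gcd_dvd_right a b
  rw [← hg] at ha' hc
  have hcop : a'.Coprime c := by
    have := Nat.coprime_div_gcd_div_gcd (m := a) (n := b) hg0
    rw [← hg] at this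
    rwa [ha', hc, Nat.mul_div_cancel_left _ hg0, Nat.mul_div_cancel_left _ hg0] at this
  have hc0 : 0 < c := Nat.pos_of_mul_pos_left (hc ▸ hb)
  have hg' : (g : ℝ) ≠ 0 := by exact_mod_cast hg0.ne'
  have hc' : (c : ℝ) ≠ 0 := by exact_mod_cast hc0.ne'
  have hbc : b / g = c := by rw [hc, Nat.mul_div_cancel_left _ hg0]
  have h1 : ∀ j : ℕ, saw (t + a * j / b) = saw (t + a' * j / c) := by
    intro j
    congr 2
    rw [ha', hc]
    push_cast
    field_simp
  have h2 : ∀ n : ℕ, ∑ j ∈ Finset.range (n * c), saw (t + a' * j / c) = n * saw (c * t) := by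
    intro n
    induction n with
    | zero => simp
    | succ n ih =>
      rw [Nat.succ_mul, Finset.sum_range_add, ih, ← sum_saw_add_mul_div_of_coprime hc0 hcop t]
      have : ∀ j ∈ Finset.range c, saw (t + a' * ((n * c + j : ℕ) : ℝ) / c)
          = saw (t + a' * j / c) := by
        intro j _
        have e : t + a' * ((n * c + j : ℕ) : ℝ) / c
            = t + a' * j / c + ((a' * n : ℕ) : ℝ) := by
          push_cast
          field_simp
          ring
        rw [e, saw_add_nat]
      rw [Finset.sum_congr rfl this]
      push_cast
      ring
  rw [hbc, Finset.sum_congr rfl fun j _ => h1 j, ← h2 g]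
  congr 2

theorem intervalIntegrable_of_abs_le {f : ℝ → ℝ} (hf : Measurable f) {C : ℝ}
    (hC : ∀ x, |f x| ≤ C) (a b : ℝ) : IntervalIntegrable f volume a b := by
  refine (intervalIntegrable_const (c := C)).mono_fun hf.aestronglyMeasurable ?_
  filter_upwards with x
  exact (hC x).trans (le_abs_self C)

theorem measurable_saw_comp (k α : ℝ) : Measurable fun x : ℝ => saw (k * x + α) :=
  measurable_saw.comp (by fun_prop)

theorem abs_saw_mul_saw_le (s t : ℝ) : |saw s * saw t| ≤ 1 / 4 := by
  rw [abs_mul]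
  calc |saw s| * |saw t| ≤ 1 / 2 * (1 / 2) :=
        mul_le_mul (abs_saw_le s) (abs_saw_le t) (abs_nonneg _) (by norm_num)
    _ = 1 / 4 := by norm_num

theorem intervalIntegrable_saw_mul_saw (k l α β a b : ℝ) :
    IntervalIntegrable (fun x => saw (k * x + α) * saw (l * x + β)) volume a b :=
  intervalIntegrable_of_abs_le ((measurable_saw_comp k α).mul (measurable_saw_comp l β))
    (fun _ => abs_saw_mul_saw_le _ _) a b

/-- Averaging over the shifts by `j / b` replaces the frequency `a` by the least common multiple
of `a` and `b`. -/
theorem integral_saw_mul_saw_eq (a : ℕ) {b : ℕ} (hb : 0 < b) (α β : ℝ) :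
    ∃ γ, ∫ x in (0 : ℝ)..1, saw (a * x + α) * saw (b * x + β)
      = (a.gcd b : ℝ) / b *
        ∫ x in (0 : ℝ)..1, saw ((b / a.gcd b * a : ℕ) * x + γ) * saw (b * x + β) := by
  have hb' : (b : ℝ) ≠ 0 := by exact_mod_cast hb.ne'
  set f : ℝ → ℝ := fun x => saw (a * x + α) * saw (b * x + β) with hf
  have hper : Function.Periodic f 1 := by
    intro x
    simp only [hf]
    rw [show (a : ℝ) * (x + 1) + α = a * x + α + (a : ℕ) by ring,
      show (b : ℝ) * (x + 1) + β = b * x + β + (b : ℕ) by ring, saw_add_nat, saw_add_nat]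
  have hshift : ∀ s : ℝ, ∫ x in (0 : ℝ)..1, f (x + s) = ∫ x in (0 : ℝ)..1, f x := by
    intro s
    rw [intervalIntegral.integral_comp_add_right]
    have := hper.intervalIntegral_add_eq s 0
    rw [zero_add] at this
    rw [zero_add, add_comm 1 s, this]
  have hsum : ∑ j ∈ Finset.range b, ∫ x in (0 : ℝ)..1, f (x + j / b)
      = b * ∫ x in (0 : ℝ)..1, f x := by
    simp [hshift]
  refine ⟨(b / a.gcd b : ℕ) * α, ?_⟩
  have hint : ∀ j ∈ Finset.range b,
      IntervalIntegrable (fun x => f (x + j / b)) volume 0 1 := by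
    intro j _
    refine intervalIntegrable_of_abs_le (C := 1 / 4) ?_ (fun _ => abs_saw_mul_saw_le _ _) 0 1
    exact ((measurable_saw_comp a α).mul (measurable_saw_comp b β)).comp (by fun_prop)
  rw [← intervalIntegral.integral_finsetSum hint] at hsum
  have hpt : ∀ x : ℝ, ∑ j ∈ Finset.range b, f (x + j / b)
      = a.gcd b * (saw ((b / a.gcd b * a : ℕ) * x + (b / a.gcd b : ℕ) * α)
        * saw (b * x + β)) := by
    intro x
    have h1 : ∀ j ∈ Finset.range b, f (x + j / b)
        = saw (a * x + α + a * j / b) * saw (b * x + β) := by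
      intro j _
      simp only [hf]
      rw [show (b : ℝ) * (x + j / b) + β = b * x + β + (j : ℕ) by field_simp; ring, saw_add_nat,
        show (a : ℝ) * (x + j / b) + α = a * x + α + a * j / b by ring]
    rw [Finset.sum_congr rfl h1, ← Finset.sum_mul, sum_saw_add_mul_div a hb, mul_assoc]
    congr 3
    push_cast
    ring
  simp only [hpt] at hsum
  rw [intervalIntegral.integral_const_mul] at hsum
  rw [div_mul_eq_mul_div, eq_div_iff hb', hsum, mul_comm]

/-- The averaging identity is used twice: it first raises the frequency a to lcm(a,b), then, with
the roles exchanged, raises b to the same lcm. The factors g/b and b/lcm multiply to g²/(ab), and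
the remaining integral is at most 1/4 trivially. -/
theorem abs_integral_saw_mul_saw_le {a b : ℕ} (ha : 0 < a) (hb : 0 < b) (α β : ℝ) :
    |∫ x in (0 : ℝ)..1, saw (a * x + α) * saw (b * x + β)|
      ≤ (a.gcd b : ℝ) ^ 2 / (a * b) / 4 := by
  obtain ⟨γ, hγ⟩ := integral_saw_mul_saw_eq a hb α β
  set g := a.gcd b with hg
  have hg0 : 0 < g := Nat.gcd_pos_of_pos_right _ hb
  have hgcd : b.gcd (b / g * a) = b := by
    refine Nat.gcd_eq_left ?_
    calc b = b / g * g := (Nat.div_mul_cancel (Nat.gcd_dvd_right a b)).symm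
      _ ∣ b / g * a := Nat.mul_dvd_mul_left _ (Nat.gcd_dvd_left a b)
  have hbg : 0 < b / g := Nat.div_pos (Nat.le_of_dvd hb (Nat.gcd_dvd_right a b)) hg0
  obtain ⟨δ, hδ⟩ := integral_saw_mul_saw_eq b (b := b / g * a) (Nat.mul_pos hbg ha) β γ
  rw [hγ]
  simp only [mul_comm (saw ((b / g * a : ℕ) * _ + γ))]
  rw [hδ, hgcd]
  have hbnd : |∫ x in (0 : ℝ)..1, saw ((b / g * a / b * b : ℕ) * x + δ)
      * saw ((b / g * a : ℕ) * x + γ)| ≤ 1 / 4 := by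
    have := intervalIntegral.norm_integral_le_of_norm_le_const (a := 0) (b := 1) (C := 1 / 4)
      (f := fun x : ℝ => saw ((b / g * a / b * b : ℕ) * x + δ)
        * saw ((b / g * a : ℕ) * x + γ)) (fun x _ => abs_saw_mul_saw_le _ _)
    simpa using this
  have hg' : (g : ℝ) ≠ 0 := by exact_mod_cast hg0.ne'
  have ha' : (a : ℝ) ≠ 0 := by exact_mod_cast ha.ne'
  have hb' : (b : ℝ) ≠ 0 := by exact_mod_cast hb.ne'
  have hcast : ((b / g * a : ℕ) : ℝ) = b / g * a := by
    rw [Nat.cast_mul, Nat.cast_div (Nat.gcd_dvd_right a b) hg']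
  have hcoef : (g : ℝ) / b * (b / ((b / g * a : ℕ) : ℝ)) = (g : ℝ) ^ 2 / (a * b) := by
    rw [hcast]
    field_simp
  rw [← mul_assoc, hcoef, abs_mul, abs_of_nonneg (by positivity), div_eq_mul_one_div _ (4 : ℝ)]
  exact mul_le_mul_of_nonneg_left hbnd (by positivity)

/-! ### Mean squares of sawtooth sums -/

/-- The term with g = gcd(a,b) is dominated by the sum over all common divisors g ≤ B. Exchanging
sums makes the expression factor for each g into two sums of g/a over multiples a of g, each at most
a harmonic sum. -/
theorem sum_gcd_sq_div_le (B : ℕ) :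
    ∑ a ∈ Finset.Icc 1 B, ∑ b ∈ Finset.Icc 1 B, (a.gcd b : ℝ) ^ 2 / (a * b)
      ≤ B * (1 + Real.log B) ^ 2 := by
  set H : ℝ := ∑ c ∈ Finset.Icc 1 B, (1 : ℝ) / c with hH
  have hHlog : H ≤ 1 + Real.log B := by
    have := harmonic_le_one_add_log B
    rw [harmonic_eq_sum_Icc] at this
    push_cast at this
    simpa [hH] using this
  have hH0 : 0 ≤ H := Finset.sum_nonneg fun c _ => by positivity
  have hmult : ∀ g ∈ Finset.Icc 1 B,
      ∑ a ∈ Finset.Icc 1 B, (if g ∣ a then (g : ℝ) / a else 0) ≤ H := by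
    intro g hg
    have hg0 : 0 < g := (Finset.mem_Icc.mp hg).1
    have hg' : (g : ℝ) ≠ 0 := by exact_mod_cast hg0.ne'
    rw [← Finset.sum_filter]
    have hinj : Set.InjOn (fun a => a / g) (({a ∈ Finset.Icc 1 B | g ∣ a} : Finset ℕ) : Set ℕ) := by
      intro a ha b hb hab
      have ha' : g ∣ a := (Finset.mem_filter.mp ha).2
      have hb' : g ∣ b := (Finset.mem_filter.mp hb).2
      exact (Nat.div_left_inj ha' hb').mp hab
    have h1 : ∑ a ∈ Finset.Icc 1 B with g ∣ a, (g : ℝ) / a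
        = ∑ c ∈ ({a ∈ Finset.Icc 1 B | g ∣ a} : Finset ℕ).image (fun a => a / g), (1 : ℝ) / c := by
      rw [Finset.sum_image hinj]
      refine Finset.sum_congr rfl fun a ha => ?_
      rw [Nat.cast_div (Finset.mem_filter.mp ha).2 hg', one_div_div]
    rw [h1]
    refine Finset.sum_le_sum_of_subset_of_nonneg ?_ fun c _ _ => by positivity
    intro c hc
    obtain ⟨a, ha, rfl⟩ := Finset.mem_image.mp hc
    obtain ⟨ha1, ha2⟩ := Finset.mem_filter.mp ha
    obtain ⟨h1, h2⟩ := Finset.mem_Icc.mp ha1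
    exact Finset.mem_Icc.mpr
      ⟨Nat.div_pos (Nat.le_of_dvd h1 ha2) hg0, (Nat.div_le_self _ _).trans h2⟩
  calc ∑ a ∈ Finset.Icc 1 B, ∑ b ∈ Finset.Icc 1 B, (a.gcd b : ℝ) ^ 2 / (a * b)
      ≤ ∑ a ∈ Finset.Icc 1 B, ∑ b ∈ Finset.Icc 1 B, ∑ g ∈ Finset.Icc 1 B,
          (if g ∣ a then (g : ℝ) / a else 0) * (if g ∣ b then (g : ℝ) / b else 0) := by
        refine Finset.sum_le_sum fun a ha => Finset.sum_le_sum fun b hb => ?_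
        obtain ⟨ha1, ha2⟩ := Finset.mem_Icc.mp ha
        have hmem : a.gcd b ∈ Finset.Icc 1 B := Finset.mem_Icc.mpr
          ⟨Nat.gcd_pos_of_pos_left _ ha1, (Nat.le_of_dvd ha1 (Nat.gcd_dvd_left a b)).trans ha2⟩
        refine le_trans (le_of_eq ?_) (Finset.single_le_sum (fun g _ => ?_) hmem)
        · rw [if_pos (Nat.gcd_dvd_left a b), if_pos (Nat.gcd_dvd_right a b), div_mul_div_comm, sq]
        · positivity
    _ = ∑ g ∈ Finset.Icc 1 B, (∑ a ∈ Finset.Icc 1 B, (if g ∣ a then (g : ℝ) / a else 0)) *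
          ∑ b ∈ Finset.Icc 1 B, (if g ∣ b then (g : ℝ) / b else 0) := by
        simp_rw [Finset.sum_mul_sum]
        symm
        rw [Finset.sum_comm]
        exact Finset.sum_congr rfl fun a _ => Finset.sum_comm
    _ ≤ ∑ g ∈ Finset.Icc 1 B, H * H := Finset.sum_le_sum fun g hg =>
        mul_le_mul (hmult g hg) (hmult g hg)
          (Finset.sum_nonneg fun b _ => by positivity) hH0
    _ = B * H ^ 2 := by simp [sq]
    _ ≤ B * (1 + Real.log B) ^ 2 := by gcongr

theorem integral_sum_saw_sq_le (B : ℕ) (α : ℕ → ℝ) :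
    ∫ x in (0 : ℝ)..1, (∑ b ∈ Finset.Icc 1 B, saw (b * x + α b)) ^ 2
      ≤ B * (1 + Real.log B) ^ 2 / 4 := by
  simp_rw [sq (∑ b ∈ Finset.Icc 1 B, saw _), Finset.sum_mul_sum]
  have hint : ∀ a ∈ Finset.Icc 1 B, IntervalIntegrable (fun x : ℝ =>
      ∑ b ∈ Finset.Icc 1 B, saw (a * x + α a) * saw (b * x + α b)) volume 0 1 := by
    intro a _
    have h := IntervalIntegrable.sum (Finset.Icc 1 B) fun b _ =>
      intervalIntegrable_saw_mul_saw a b (α a) (α b) 0 1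
    rwa [show ∑ b ∈ Finset.Icc 1 B, (fun x : ℝ => saw (a * x + α a) * saw (b * x + α b))
      = fun x => ∑ b ∈ Finset.Icc 1 B, saw (a * x + α a) * saw (b * x + α b) by ext x; simp] at h
  rw [intervalIntegral.integral_finsetSum hint]
  calc _ = ∑ a ∈ Finset.Icc 1 B, ∑ b ∈ Finset.Icc 1 B,
        ∫ x in (0 : ℝ)..1, saw (a * x + α a) * saw (b * x + α b) :=
        Finset.sum_congr rfl fun a _ => intervalIntegral.integral_finsetSum fun b _ =>
          intervalIntegrable_saw_mul_saw _ _ _ _ _ _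
    _ ≤ ∑ a ∈ Finset.Icc 1 B, ∑ b ∈ Finset.Icc 1 B, (a.gcd b : ℝ) ^ 2 / (a * b) / 4 :=
        Finset.sum_le_sum fun a ha => Finset.sum_le_sum fun b hb => (le_abs_self _).trans
          (abs_integral_saw_mul_saw_le (Finset.mem_Icc.mp ha).1 (Finset.mem_Icc.mp hb).1 _ _)
    _ ≤ B * (1 + Real.log B) ^ 2 / 4 := by
        simp_rw [← Finset.sum_div]
        exact div_le_div_of_nonneg_right (sum_gcd_sq_div_le B) (by norm_num)

theorem integral_sum_saw_neg_sq_le (B : ℕ) (α : ℕ → ℝ) :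
    ∫ x in (0 : ℝ)..1, (∑ b ∈ Finset.Icc 1 B, saw (-(b * x) + α b)) ^ 2
      ≤ B * (1 + Real.log B) ^ 2 / 4 := by
  have h := intervalIntegral.integral_comp_sub_left (a := 0) (b := 1)
    (fun x : ℝ => (∑ b ∈ Finset.Icc 1 B, saw (-(b * x) + α b)) ^ 2) 1
  rw [sub_self, sub_zero] at h
  rw [← h]
  refine le_trans (le_of_eq ?_) (integral_sum_saw_sq_le B fun b => α b - b)
  congr 1
  ext x
  congr 1
  refine Finset.sum_congr rfl fun b _ => ?_
  congr 1
  ring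

/-! ### Trapezoidal sums for the half-disc -/

theorem trapezoid_le_integral_of_concaveOn {f : ℝ → ℝ} (hc : Continuous f) {a : ℝ}
    (hf : ConcaveOn ℝ (Set.Icc a (a + 1)) f) :
    (f a + f (a + 1)) / 2 ≤ ∫ x in a..a + 1, f x := by
  have h1 : ∫ x in a..a + 1, (f a + (x - a) * (f (a + 1) - f a)) = (f a + f (a + 1)) / 2 := by
    rw [intervalIntegral.integral_add (Continuous.intervalIntegrable (by fun_prop) _ _)
      (Continuous.intervalIntegrable (by fun_prop) _ _),
      intervalIntegral.integral_mul_const,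
      intervalIntegral.integral_sub (Continuous.intervalIntegrable (by fun_prop) _ _)
        (Continuous.intervalIntegrable (by fun_prop) _ _)]
    simp
    ring
  rw [← h1]
  refine intervalIntegral.integral_mono_on (by linarith)
    (Continuous.intervalIntegrable (by fun_prop) _ _) (hc.intervalIntegrable _ _) fun x hx => ?_
  have h := hf.2 (Set.left_mem_Icc.mpr (by linarith : a ≤ a + 1))
    (Set.right_mem_Icc.mpr (by linarith)) (sub_nonneg.mpr hx.2) (sub_nonneg.mpr hx.1) (by ring)
  simp only [smul_eq_mul] at h
  rw [show (a + 1 - x) * a + (x - a) * (a + 1) = x by ring] at h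
  linarith

/-- Pairing x with its reflection 2m − x, concavity bounds the average of the two values by f m. -/
theorem integral_le_midpoint_of_concaveOn {f : ℝ → ℝ} (hc : Continuous f) {m : ℝ}
    (hf : ConcaveOn ℝ (Set.Icc (m - 1 / 2) (m + 1 / 2)) f) :
    ∫ x in m - 1 / 2..m + 1 / 2, f x ≤ f m := by
  have h1 := intervalIntegral.integral_comp_sub_left (a := m - 1 / 2) (b := m + 1 / 2) f (2 * m)
  rw [show 2 * m - (m + 1 / 2) = m - 1 / 2 by ring,
    show 2 * m - (m - 1 / 2) = m + 1 / 2 by ring] at h1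
  have h2 : ∫ x in m - 1 / 2..m + 1 / 2, (f x + f (2 * m - x))
      ≤ ∫ x in m - 1 / 2..m + 1 / 2, 2 * f m := by
    refine intervalIntegral.integral_mono_on (by linarith)
      (Continuous.intervalIntegrable (by fun_prop) _ _) (by simp) fun x hx => ?_
    have h := hf.2 hx (show 2 * m - x ∈ _ from ⟨by linarith [hx.2], by linarith [hx.1]⟩)
      (show (0 : ℝ) ≤ 1 / 2 by norm_num) (show (0 : ℝ) ≤ 1 / 2 by norm_num) (by norm_num)
    simp only [smul_eq_mul] at h
    rw [show 1 / 2 * x + 1 / 2 * (2 * m - x) = m by ring] at h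
    linarith
  rw [intervalIntegral.integral_add (hc.intervalIntegrable _ _)
    (Continuous.intervalIntegrable (by fun_prop) _ _), h1] at h2
  simp at h2
  norm_num at h2 ⊢
  linarith

/-- The points (u, p) and (v, q) lie on the circle of radius A, so their inner product is at most
A²; hence their convex combination stays in the disc. -/
theorem concaveOn_sqrt_sq_sub_sq (A : ℝ) :
    ConcaveOn ℝ (Set.Icc (-A) A) fun x => √(A ^ 2 - x ^ 2) := by
  refine ⟨convex_Icc _ _, fun u hu v hv s t hs ht hst => ?_⟩
  have hu2 : 0 ≤ A ^ 2 - u ^ 2 := by nlinarith [hu.1, hu.2]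
  have hv2 : 0 ≤ A ^ 2 - v ^ 2 := by nlinarith [hv.1, hv.2]
  simp only [smul_eq_mul]
  refine Real.le_sqrt_of_sq_le ?_
  have hp := Real.sq_sqrt hu2
  have hq := Real.sq_sqrt hv2
  set p := √(A ^ 2 - u ^ 2)
  set q := √(A ^ 2 - v ^ 2)
  have hpq : p * q + u * v ≤ A ^ 2 := by nlinarith [sq_nonneg (p - q), sq_nonneg (u - v)]
  have hst2 : (s + t) ^ 2 = 1 := by rw [hst]; norm_num
  have := mul_le_mul_of_nonneg_left hpq (mul_nonneg hs ht)
  have e : (s * p + t * q) ^ 2 + (s * u + t * v) ^ 2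
      = s ^ 2 * (p ^ 2 + u ^ 2) + t ^ 2 * (q ^ 2 + v ^ 2) + 2 * (s * t * (p * q + u * v)) := by ring
  rw [hp, hq] at e
  have e2 : A ^ 2 = (s + t) ^ 2 * A ^ 2 := by rw [hst2, one_mul]
  linarith

theorem integral_sqrt_sq_sub_sq {A : ℝ} (hA : 0 ≤ A) :
    ∫ x in (0 : ℝ)..A, √(A ^ 2 - x ^ 2) = Real.pi * A ^ 2 / 4 := by
  have h1 : ∫ x in (0 : ℝ)..1, √(1 - x ^ 2) = Real.pi / 4 := by
    have h := integral_sqrt_one_sub_sq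
    have hc : Continuous fun x : ℝ => √(1 - x ^ 2) := by fun_prop
    rw [← intervalIntegral.integral_add_adjacent_intervals (hc.intervalIntegrable (-1) 0)
      (hc.intervalIntegrable 0 1)] at h
    have h2 := intervalIntegral.integral_comp_neg (a := 0) (b := 1) fun x : ℝ => √(1 - x ^ 2)
    simp only [neg_sq, neg_zero] at h2
    linarith
  have h := intervalIntegral.mul_integral_comp_mul_left (a := 0) (b := 1)
    (f := fun x : ℝ => √(A ^ 2 - x ^ 2)) (c := A)
  rw [mul_zero, mul_one] at h
  rw [← h]
  have h3 : ∀ x : ℝ, √(A ^ 2 - (A * x) ^ 2) = A * √(1 - x ^ 2) := by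
    intro x
    rw [show A ^ 2 - (A * x) ^ 2 = A ^ 2 * (1 - x ^ 2) by ring, Real.sqrt_mul (sq_nonneg A),
      Real.sqrt_sq hA]
  simp only [h3, intervalIntegral.integral_const_mul, h1]
  ring

/-- The trapezoidal sum for the area of a half-disc of radius `A`. -/
theorem abs_sum_sqrt_sub_le {A : ℝ} {n : ℕ} (hn : (n : ℝ) ≤ A) (hA : A ≤ n + 1) :
    |√(A ^ 2) + 2 * ∑ b ∈ Finset.Icc 1 n, √(A ^ 2 - (b : ℝ) ^ 2) - Real.pi * A ^ 2 / 2|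
      ≤ 6 * √A + 2 := by
  have hn0 : (0 : ℝ) ≤ n := n.cast_nonneg
  have hA0 : 0 ≤ A := hn0.trans hn
  set f : ℝ → ℝ := fun x => √(A ^ 2 - x ^ 2) with hf
  have hc : Continuous f := by fun_prop
  have hf0 : ∀ x, 0 ≤ f x := fun x => Real.sqrt_nonneg _
  have hconc := concaveOn_sqrt_sq_sub_sq A
  have hf00 : √(A ^ 2) = f 0 := by simp [hf]
  have hI := integral_sqrt_sq_sub_sq hA0
  have hii : ∀ a b, IntervalIntegrable f volume a b := fun a b => hc.intervalIntegrable a b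
  have hsplit : ∀ u, (∫ x in (0 : ℝ)..u, f x) + ∫ x in u..A, f x = Real.pi * A ^ 2 / 4 := by
    intro u
    rw [intervalIntegral.integral_add_adjacent_intervals (hii _ _) (hii _ _), ← hI]
  have hanti : ∀ u x : ℝ, 0 ≤ u → u ≤ x → f x ≤ f u := fun u x hu hx =>
    Real.sqrt_le_sqrt (by nlinarith)
  have hsA := Real.sqrt_nonneg A
  -- A² − u² = (A − u)(A + u) ≤ (3/2)(2A) ≤ 4A. The length 3/2 is the longest end piece left over
  -- below.
  have hbound : ∀ u : ℝ, 0 ≤ u → u ≤ A → A - u ≤ 3 / 2 → f u ≤ 2 * √A := by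
    intro u hu huA hu2
    rw [hf]
    refine Real.sqrt_le_iff.mpr ⟨by positivity, ?_⟩
    rw [mul_pow, Real.sq_sqrt hA0]
    nlinarith
  have hup : f 0 + 2 * ∑ b ∈ Finset.Icc 1 n, f b - f n ≤ 2 * ∫ x in (0 : ℝ)..n, f x := by
    have key : ∀ k : ℕ, (k : ℝ) ≤ A →
        f 0 + 2 * ∑ b ∈ Finset.Icc 1 k, f b - f k ≤ 2 * ∫ x in (0 : ℝ)..k, f x := by
      intro k
      induction k with
      | zero => simp
      | succ k ih =>
        intro hk
        have hk0 : (0 : ℝ) ≤ k := k.cast_nonneg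
        push_cast at hk ⊢
        have h1 := ih (by linarith)
        have h2 := trapezoid_le_integral_of_concaveOn hc (a := k)
          (hconc.subset (Set.Icc_subset_Icc (by linarith) hk) (convex_Icc _ _))
        have h3 := intervalIntegral.integral_add_adjacent_intervals (hii 0 k) (hii k (k + 1))
        rw [Finset.sum_Icc_succ_top (by omega)]
        push_cast
        linarith
    exact key n hn
  have hlow : ∀ k : ℕ, (k : ℝ) + 1 ≤ A →
      2 * ∫ x in (0 : ℝ)..k + 1 / 2, f x ≤ f 0 + 2 * ∑ b ∈ Finset.Icc 1 k, f b := by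
    intro k
    induction k with
    | zero =>
      intro _
      have : ∫ x in (0 : ℝ)..1 / 2, f x ≤ ∫ x in (0 : ℝ)..1 / 2, f 0 :=
        intervalIntegral.integral_mono_on (by norm_num) (hii _ _) (by simp)
          fun x hx => hanti 0 x le_rfl hx.1
      simp at this
      norm_num at this ⊢
      linarith
    | succ k ih =>
      intro hk
      have hk0 : (0 : ℝ) ≤ k := k.cast_nonneg
      push_cast at hk ⊢
      have h1 := ih (by linarith)
      have h2 := integral_le_midpoint_of_concaveOn hc (m := k + 1)
        (hconc.subset (Set.Icc_subset_Icc (by linarith) (by linarith)) (convex_Icc _ _))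
      rw [show (k : ℝ) + 1 - 1 / 2 = k + 1 / 2 by ring] at h2
      have h3 := intervalIntegral.integral_add_adjacent_intervals (hii 0 (k + 1 / 2))
        (hii (k + 1 / 2) (k + 1 + 1 / 2))
      rw [Finset.sum_Icc_succ_top (by omega)]
      push_cast
      linarith
  rw [hf00]
  change |f 0 + 2 * ∑ b ∈ Finset.Icc 1 n, f b - Real.pi * A ^ 2 / 2| ≤ _
  have hsum0 : ∀ k : ℕ, 0 ≤ ∑ b ∈ Finset.Icc 1 k, f b := fun k =>
    Finset.sum_nonneg fun b _ => hf0 b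
  rw [abs_le]
  constructor
  -- The midpoint bound is used only up to m = n − 1, so that every interval stays inside [0, A];
  -- the uncovered piece [m + 1/2, A] has length at most 3/2. For n = 0 the whole area is at most 2.
  · rcases n with _ | m
    · have : A ^ 2 ≤ 1 := by
        have : A ≤ 1 := by simpa using hA
        nlinarith
      have hpi := Real.pi_le_four
      have := hf0 0
      have := hsum0 0
      nlinarith [Real.pi_pos]
    · have hm0 : (0 : ℝ) ≤ m := m.cast_nonneg
      push_cast at hn hA
      have h1 := hlow m hn
      have h2 : ∫ x in (m + 1 / 2 : ℝ)..A, f x ≤ ∫ x in (m + 1 / 2 : ℝ)..A, 2 * √A :=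
        intervalIntegral.integral_mono_on (by linarith) (hii _ _) (by simp) fun x hx =>
          (hanti (m + 1 / 2) x (by positivity) hx.1).trans
            (hbound (m + 1 / 2) (by positivity) (by linarith) (by linarith))
      rw [intervalIntegral.integral_const, smul_eq_mul] at h2
      have h3 : (A - (m + 1 / 2)) * (2 * √A) ≤ 3 / 2 * (2 * √A) := by gcongr; linarith
      have h4 := hsplit (m + 1 / 2)
      rw [Finset.sum_Icc_succ_top (by omega)]
      have := hf0 (m + 1 : ℕ)
      linarith
  · have h1 := hbound n hn0 hn (by linarith)
    have h2 := hsplit n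
    have h3 : 0 ≤ ∫ x in (n : ℝ)..A, f x :=
      intervalIntegral.integral_nonneg hn fun x _ => hf0 x
    linarith

/-! ### Counting lattice points line by line -/

theorem sum_Icc_neg_int {M : Type*} [AddCommMonoid M] (F : ℤ → M) (n : ℕ) :
    ∑ b ∈ Finset.Icc (-n : ℤ) n, F b = F 0 + ∑ b ∈ Finset.Icc 1 n, (F b + F (-b)) := by
  induction n with
  | zero => simp
  | succ n ih =>
    have h : Finset.Icc (-(n + 1 : ℕ) : ℤ) (n + 1 : ℕ)
        = insert ((n + 1 : ℕ) : ℤ) (insert (-(n + 1 : ℕ) : ℤ) (Finset.Icc (-n : ℤ) n)) := by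
      ext k
      simp only [Finset.mem_Icc, Finset.mem_insert]
      omega
    rw [h, Finset.sum_insert (by simp only [Finset.mem_insert, Finset.mem_Icc]; omega),
      Finset.sum_insert (by simp only [Finset.mem_Icc]; omega), ih,
      Finset.sum_Icc_succ_top (by omega)]
    abel

/-- The number of integers `a` with `|a + s| < r`. -/
theorem card_Ioo_floor_ceil {r s : ℝ} (hr : 0 < r) :
    ((Finset.Ioo ⌊-r - s⌋ ⌈r - s⌉).card : ℝ) = 2 * r + saw (s - r) + saw (-s - r) := by
  have hlt : ⌊-r - s⌋ < ⌈r - s⌉ := by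
    rw [Int.lt_ceil]
    exact (Int.floor_le _).trans_lt (by linarith)
  have hZ : ((Finset.Ioo ⌊-r - s⌋ ⌈r - s⌉).card : ℤ) = ⌈r - s⌉ - ⌊-r - s⌋ - 1 := by
    rw [Int.card_Ioo]
    omega
  have hR : ((Finset.Ioo ⌊-r - s⌋ ⌈r - s⌉).card : ℝ) = ⌈r - s⌉ - ⌊-r - s⌋ - 1 := by
    exact_mod_cast hZ
  rw [hR, saw, saw, Int.fract, Int.fract, show s - r = -(r - s) by ring, Int.floor_neg,
    show -s - r = -r - s by ring]
  push_cast
  ring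

/-- The imaginary part of `g • i`. -/
noncomputable def imPart (g : SL(2, ℝ)) : ℝ := (g 1 0 ^ 2 + g 1 1 ^ 2)⁻¹

/-- The real part of `g • i`. -/
noncomputable def rePart (g : SL(2, ℝ)) : ℝ := imPart g * (g 0 0 * g 1 0 + g 0 1 * g 1 1)

theorem det_eq_one (g : SL(2, ℝ)) : g 0 0 * g 1 1 - g 0 1 * g 1 0 = 1 := by
  rw [← Matrix.det_fin_two]
  exact g.det_coe

theorem bottom_sq_pos (g : SL(2, ℝ)) : 0 < g 1 0 ^ 2 + g 1 1 ^ 2 := by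
  have h := det_eq_one g
  by_contra hle
  have h0 : g 1 0 = 0 := by nlinarith [sq_nonneg (g 1 0), sq_nonneg (g 1 1)]
  have h1 : g 1 1 = 0 := by nlinarith [sq_nonneg (g 1 0), sq_nonneg (g 1 1)]
  rw [h0, h1] at h
  norm_num at h

theorem imPart_pos (g : SL(2, ℝ)) : 0 < imPart g := inv_pos.mpr (bottom_sq_pos g)

theorem imPart_mul_bottom (g : SL(2, ℝ)) : imPart g * (g 1 0 ^ 2 + g 1 1 ^ 2) = 1 :=
  inv_mul_cancel₀ (bottom_sq_pos g).ne'

/-- Lagrange's identity for the two rows, whose determinant is 1. -/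
theorem imPart_mul_top (g : SL(2, ℝ)) :
    imPart g * (g 0 0 ^ 2 + g 0 1 ^ 2) = rePart g ^ 2 + imPart g ^ 2 := by
  have h1 := imPart_mul_bottom g
  have h2 := det_eq_one g
  rw [rePart]
  set y := imPart g
  calc y * (g 0 0 ^ 2 + g 0 1 ^ 2)
      = y * (g 0 0 ^ 2 + g 0 1 ^ 2) * (y * (g 1 0 ^ 2 + g 1 1 ^ 2)) := by rw [h1, mul_one]
    _ = (y * (g 0 0 * g 1 0 + g 0 1 * g 1 1)) ^ 2
        + y ^ 2 * (g 0 0 * g 1 1 - g 0 1 * g 1 0) ^ 2 := by ring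
    _ = _ := by rw [h2]; ring

theorem norm_vecMul_sq (g : SL(2, ℝ)) (m : Fin 2 → ℤ) :
    ‖WithLp.toLp 2 ((fun i => (m i : ℝ)) ᵥ* (g : Matrix (Fin 2) (Fin 2) ℝ))‖ ^ 2
      = ((m 1 + m 0 * rePart g) ^ 2 + (m 0 * imPart g) ^ 2) / imPart g := by
  rw [eq_div_iff (imPart_pos g).ne', EuclideanSpace.norm_sq_eq]
  have h1 := imPart_mul_bottom g
  have h2 := imPart_mul_top g
  have h3 : rePart g = imPart g * (g 0 0 * g 1 0 + g 0 1 * g 1 1) := rfl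
  simp only [Fin.sum_univ_two, Matrix.vecMul, dotProduct, Real.norm_eq_abs, sq_abs]
  linear_combination (m 1 : ℝ) ^ 2 * h1 + (m 0 : ℝ) ^ 2 * h2 - 2 * m 0 * m 1 * h3

/-- For |m 0| ≥ T/√y the real square root is 0 and both sides are false, so empty lines need no
separate treatment. -/
theorem norm_vecMul_lt_iff (g : SL(2, ℝ)) (m : Fin 2 → ℤ) {T : ℝ} (hT : 0 < T) :
    ‖WithLp.toLp 2 ((fun i => (m i : ℝ)) ᵥ* (g : Matrix (Fin 2) (Fin 2) ℝ))‖ < T ↔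
      |(m 1 : ℝ) + m 0 * rePart g| < imPart g * √((T / √(imPart g)) ^ 2 - (m 0 : ℝ) ^ 2) := by
  have hy := imPart_pos g
  rw [← sq_lt_sq₀ (norm_nonneg _) hT.le, norm_vecMul_sq, div_lt_iff₀ hy,
    ← div_lt_iff₀' hy, Real.lt_sqrt (by positivity), div_pow, div_pow, sq_abs, Real.sq_sqrt hy.le,
    div_lt_iff₀ (by positivity), sub_mul, ← sub_pos, ← sub_pos (b := (_ : ℝ) ^ 2)]
  have : T ^ 2 / imPart g * imPart g ^ 2 = T ^ 2 * imPart g := by field_simp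
  rw [this]
  constructor <;> intro h <;> nlinarith

theorem vecMul_injective (g : SL(2, ℝ)) : Function.Injective fun m : Fin 2 → ℤ =>
    (WithLp.toLp 2 ((fun i => (m i : ℝ)) ᵥ* (g : Matrix (Fin 2) (Fin 2) ℝ)) :
      EuclideanSpace ℝ (Fin 2)) := by
  intro m m' h
  have h0 := congrArg (fun w : EuclideanSpace ℝ (Fin 2) => w 0) h
  have h1 := congrArg (fun w : EuclideanSpace ℝ (Fin 2) => w 1) h
  simp only [Matrix.vecMul, dotProduct, Fin.sum_univ_two] at h0 h1
  have hd := det_eq_one g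
  have e0 : (m 0 : ℝ) = m' 0 := by
    linear_combination g 1 1 * h0 - g 1 0 * h1 - ((m 0 : ℝ) - m' 0) * hd
  have e1 : (m 1 : ℝ) = m' 1 := by
    linear_combination g 0 0 * h1 - g 0 1 * h0 - ((m 1 : ℝ) - m' 1) * hd
  ext i
  fin_cases i
  · exact_mod_cast e0
  · exact_mod_cast e1

/-- The coordinates of the lattice points in a disc. -/
def coordsLT (g : SL(2, ℝ)) (T : ℝ) : Set (Fin 2 → ℤ) :=
  {m | ‖(WithLp.toLp 2 ((fun i => (m i : ℝ)) ᵥ* (g : Matrix (Fin 2) (Fin 2) ℝ)) :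
    EuclideanSpace ℝ (Fin 2))‖ < T}

theorem count_proj_eq_ncard (g : SL(2, ℝ)) (T : ℝ) :
    count (proj g) T = (coordsLT g T).ncard := by
  rw [count, ← Set.ncard_image_of_injective (coordsLT g T) (vecMul_injective g)]
  congr 1
  ext w
  constructor
  · rintro ⟨⟨m, rfl⟩, hw⟩
    exact ⟨m, hw, rfl⟩
  · rintro ⟨m, hm, rfl⟩
    exact ⟨⟨m, rfl⟩, hm⟩

theorem coordsLT_eq_image (g : SL(2, ℝ)) {T : ℝ} (hT : 0 < T) {n : ℕ}
    (hn : T / √(imPart g) ≤ n + 1) :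
    coordsLT g T = (fun p : Σ _ : ℤ, ℤ => ![p.1, p.2]) '' ((Finset.Icc (-n : ℤ) n).sigma fun b =>
      Finset.Ioo ⌊-(imPart g * √((T / √(imPart g)) ^ 2 - (b : ℝ) ^ 2)) - b * rePart g⌋
        ⌈imPart g * √((T / √(imPart g)) ^ 2 - (b : ℝ) ^ 2) - b * rePart g⌉) := by
  have hy := imPart_pos g
  ext m
  rw [coordsLT, Set.mem_ofPred_eq, norm_vecMul_lt_iff g _ hT, abs_lt]
  set A := T / √(imPart g)
  have hA0 : 0 ≤ A := by positivity
  constructor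
  · rintro ⟨h1, h2⟩
    refine ⟨⟨m 0, m 1⟩, ?_, by ext i; fin_cases i <;> rfl⟩
    rw [Finset.mem_coe, Finset.mem_sigma, Finset.mem_Ioo, Int.floor_lt, Int.lt_ceil]
    refine ⟨?_, by linarith, by linarith⟩
    have hpos : 0 < imPart g * √(A ^ 2 - (m 0 : ℝ) ^ 2) := by linarith
    have h3 : 0 < A ^ 2 - (m 0 : ℝ) ^ 2 := Real.sqrt_pos.mp (pos_of_mul_pos_right hpos hy.le)
    have h4 : |(m 0 : ℝ)| < n + 1 := (abs_lt_of_sq_lt_sq (sub_pos.mp h3) hA0).trans_le hn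
    have h5 : |m 0| < (n : ℤ) + 1 := by exact_mod_cast h4
    rw [abs_lt] at h5
    exact Finset.mem_Icc.mpr ⟨by have := h5.1; dsimp only; omega,
      by have := h5.2; dsimp only; omega⟩
  · rintro ⟨⟨b, a⟩, hp, rfl⟩
    rw [Finset.mem_coe, Finset.mem_sigma, Finset.mem_Ioo, Int.floor_lt, Int.lt_ceil] at hp
    simp only [Matrix.cons_val_zero, Matrix.cons_val_one]
    obtain ⟨-, h1, h2⟩ := hp
    constructor <;> linarith

theorem finite_coordsLT (g : SL(2, ℝ)) {T : ℝ} (hT : 0 < T) : (coordsLT g T).Finite := by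
  obtain ⟨n, hn⟩ := exists_nat_ge (T / √(imPart g))
  rw [coordsLT_eq_image g hT (n := n) (by linarith)]
  exact (Finset.finite_toSet _).image _

/-- The lattice points in a disc, counted line by line. -/
theorem count_proj_eq_sum (g : SL(2, ℝ)) {T : ℝ} (hT : 0 < T) {n : ℕ}
    (hn : T / √(imPart g) ≤ n + 1) :
    count (proj g) T = ∑ b ∈ Finset.Icc (-n : ℤ) n,
      (Finset.Ioo ⌊-(imPart g * √((T / √(imPart g)) ^ 2 - (b : ℝ) ^ 2)) - b * rePart g⌋
        ⌈imPart g * √((T / √(imPart g)) ^ 2 - (b : ℝ) ^ 2) - b * rePart g⌉).card := by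
  have hinj : Function.Injective fun p : Σ _ : ℤ, ℤ => ![p.1, p.2] := by
    rintro ⟨b, a⟩ ⟨b', a'⟩ h
    have h0 : b = b' := congrFun h 0
    have h1 : a = a' := congrFun h 1
    rw [h0, h1]
  rw [count_proj_eq_ncard, coordsLT_eq_image g hT hn, Set.ncard_image_of_injective _ hinj,
    Set.ncard_coe_finset, Finset.card_sigma]

/-- The lines b and −b contribute equally, and πT² = y·πA² matches the area in the trapezoidal sum.
The strict bound n < A makes every half-length positive, as the count on a single line requires. -/
theorem remainder_proj_eq (g : SL(2, ℝ)) {T : ℝ} (hT : 0 < T) {n : ℕ}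
    (hn : n < T / √(imPart g)) (hn' : T / √(imPart g) ≤ n + 1) :
    remainder (proj g) T =
      2 * imPart g * (√((T / √(imPart g)) ^ 2)
        + 2 * ∑ b ∈ Finset.Icc 1 n, √((T / √(imPart g)) ^ 2 - (b : ℝ) ^ 2)
        - Real.pi * (T / √(imPart g)) ^ 2 / 2)
      + 2 * saw (-(imPart g * √((T / √(imPart g)) ^ 2)))
      + 2 * ∑ b ∈ Finset.Icc 1 n,
        saw (b * rePart g - imPart g * √((T / √(imPart g)) ^ 2 - (b : ℝ) ^ 2))
      + 2 * ∑ b ∈ Finset.Icc 1 n,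
        saw (-(b * rePart g) - imPart g * √((T / √(imPart g)) ^ 2 - (b : ℝ) ^ 2)) := by
  have hy := imPart_pos g
  rw [remainder, count_proj_eq_sum g hT hn']
  set A := T / √(imPart g) with hA
  have hTA : T ^ 2 = imPart g * A ^ 2 := by
    rw [hA, div_pow, Real.sq_sqrt hy.le]
    field_simp
  push_cast
  have hcard : ∀ b ∈ Finset.Icc (-n : ℤ) n,
      ((Finset.Ioo ⌊-(imPart g * √(A ^ 2 - (b : ℝ) ^ 2)) - b * rePart g⌋
        ⌈imPart g * √(A ^ 2 - (b : ℝ) ^ 2) - b * rePart g⌉).card : ℝ)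
      = 2 * (imPart g * √(A ^ 2 - (b : ℝ) ^ 2))
        + saw (b * rePart g - imPart g * √(A ^ 2 - (b : ℝ) ^ 2))
        + saw (-(b * rePart g) - imPart g * √(A ^ 2 - (b : ℝ) ^ 2)) := by
    intro b hb
    refine card_Ioo_floor_ceil (mul_pos hy (Real.sqrt_pos.mpr ?_))
    obtain ⟨h1, h2⟩ := Finset.mem_Icc.mp hb
    have h1' : (-n : ℝ) ≤ b := by exact_mod_cast h1
    have h2' : (b : ℝ) ≤ n := by exact_mod_cast h2
    nlinarith
  rw [Finset.sum_congr rfl hcard, sum_Icc_neg_int, hTA]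
  push_cast
  have hpair : ∀ b ∈ Finset.Icc 1 n,
      (2 * (imPart g * √(A ^ 2 - (b : ℝ) ^ 2))
        + saw (b * rePart g - imPart g * √(A ^ 2 - (b : ℝ) ^ 2))
        + saw (-(b * rePart g) - imPart g * √(A ^ 2 - (b : ℝ) ^ 2))
      + (2 * (imPart g * √(A ^ 2 - (-(b : ℝ)) ^ 2))
        + saw (-(b : ℝ) * rePart g - imPart g * √(A ^ 2 - (-(b : ℝ)) ^ 2))
        + saw (-(-(b : ℝ) * rePart g) - imPart g * √(A ^ 2 - (-(b : ℝ)) ^ 2))))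
      = 4 * imPart g * √(A ^ 2 - (b : ℝ) ^ 2)
        + 2 * saw (b * rePart g - imPart g * √(A ^ 2 - (b : ℝ) ^ 2))
        + 2 * saw (-(b * rePart g) - imPart g * √(A ^ 2 - (b : ℝ) ^ 2)) := by
    intro b _
    rw [neg_sq, neg_mul, neg_neg]
    ring
  rw [Finset.sum_congr rfl hpair, Finset.sum_add_distrib, Finset.sum_add_distrib,
    ← Finset.mul_sum, ← Finset.mul_sum, ← Finset.mul_sum]
  simp only [zero_mul, neg_zero, zero_sub, ne_eq, OfNat.ofNat_ne_zero, not_false_eq_true, zero_pow,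
    sub_zero]
  ring

/-! ### Mean square along horocycles -/

/-- The unipotent matrix `(1 t; 0 1)`, acting on the upper half plane by translation by `t`. -/
def unip (t : ℝ) : SL(2, ℝ) := ⟨!![1, t; 0, 1], by simp [Matrix.det_fin_two]⟩

theorem unip_mul_zero (t : ℝ) (g : SL(2, ℝ)) (j : Fin 2) :
    (unip t * g) 0 j = g 0 j + t * g 1 j := by
  change ((!![1, t; 0, 1] : Matrix (Fin 2) (Fin 2) ℝ) * (g : Matrix (Fin 2) (Fin 2) ℝ)) 0 j = _
  simp [Matrix.mul_apply, Fin.sum_univ_two]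

theorem unip_mul_one (t : ℝ) (g : SL(2, ℝ)) (j : Fin 2) : (unip t * g) 1 j = g 1 j := by
  change ((!![1, t; 0, 1] : Matrix (Fin 2) (Fin 2) ℝ) * (g : Matrix (Fin 2) (Fin 2) ℝ)) 1 j = _
  simp [Matrix.mul_apply, Fin.sum_univ_two]

theorem imPart_unip_mul (t : ℝ) (g : SL(2, ℝ)) : imPart (unip t * g) = imPart g := by
  simp only [imPart, unip_mul_one]

theorem rePart_unip_mul (t : ℝ) (g : SL(2, ℝ)) : rePart (unip t * g) = rePart g + t := by
  have h := imPart_mul_bottom g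
  simp only [rePart, imPart_unip_mul, unip_mul_zero, unip_mul_one]
  linear_combination t * h

theorem abs_sum_saw_le (n : ℕ) (u : ℕ → ℝ) : |∑ b ∈ Finset.Icc 1 n, saw (u b)| ≤ n := by
  calc |∑ b ∈ Finset.Icc 1 n, saw (u b)| ≤ ∑ b ∈ Finset.Icc 1 n, |saw (u b)| :=
        Finset.abs_sum_le_sum_abs _ _
    _ ≤ ∑ b ∈ Finset.Icc 1 n, (1 : ℝ) :=
        Finset.sum_le_sum fun b _ => (abs_saw_le _).trans (by norm_num)
    _ = n := by simp

theorem intervalIntegrable_sum_saw_sq (n : ℕ) (k α : ℕ → ℝ) :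
    IntervalIntegrable (fun t => (∑ b ∈ Finset.Icc 1 n, saw (k b * t + α b)) ^ 2) volume 0 1 := by
  refine intervalIntegrable_of_abs_le (C := (n : ℝ) ^ 2) ?_ (fun t => ?_) 0 1
  · exact (Finset.measurable_fun_sum _ fun b _ => measurable_saw_comp (k b) (α b)).pow_const 2
  · rw [abs_pow]
    exact pow_le_pow_left₀ (abs_nonneg _) (abs_sum_saw_le n _) 2

theorem sq_add_add_le (a b c : ℝ) :
    (a + 2 * b + 2 * c) ^ 2 ≤ 3 * a ^ 2 + 12 * b ^ 2 + 12 * c ^ 2 := by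
  nlinarith [sq_nonneg (a - 2 * b), sq_nonneg (a - 2 * c), sq_nonneg (b - c)]

/-- Along the horocycle E and the phases are constant and only the terms ±bt move, so the
mean-square bounds for sawtooth sums apply directly to both sums. -/
theorem lintegral_remainder_unip_mul_sq_le (g : SL(2, ℝ)) {T : ℝ} (hT : 0 < T) {n : ℕ}
    (hn : n < T / √(imPart g)) (hn' : T / √(imPart g) ≤ n + 1) :
    ∫⁻ t in Set.Ioc (0 : ℝ) 1, ENNReal.ofReal (|remainder (proj (unip t * g)) T| ^ 2)
      ≤ ENNReal.ofReal (3 * (2 * imPart g * (6 * √(T / √(imPart g)) + 2) + 1) ^ 2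
        + 6 * (n * (1 + Real.log n) ^ 2)) := by
  have hy := imPart_pos g
  have hsum := abs_sum_sqrt_sub_le hn.le hn'
  have hrem := fun t => remainder_proj_eq (unip t * g) hT (n := n)
  simp only [imPart_unip_mul, rePart_unip_mul] at hrem
  set A := T / √(imPart g)
  set E := 2 * imPart g * (√(A ^ 2) + 2 * ∑ b ∈ Finset.Icc 1 n, √(A ^ 2 - (b : ℝ) ^ 2)
        - Real.pi * A ^ 2 / 2) + 2 * saw (-(imPart g * √(A ^ 2))) with hE
  have hEle : |E| ≤ 2 * imPart g * (6 * √A + 2) + 1 := by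
    rw [hE]
    refine (abs_add_le _ _).trans (add_le_add ?_ ?_)
    · rw [abs_mul, abs_of_pos (by positivity : 0 < 2 * imPart g)]
      exact mul_le_mul_of_nonneg_left hsum (by positivity)
    · rw [abs_mul]
      have := abs_saw_le (-(imPart g * √(A ^ 2)))
      norm_num
      linarith
  have hE2 : E ^ 2 ≤ (2 * imPart g * (6 * √A + 2) + 1) ^ 2 := by
    rw [← sq_abs E]
    exact pow_le_pow_left₀ (abs_nonneg _) hEle 2
  set α : ℕ → ℝ := fun b => b * rePart g - imPart g * √(A ^ 2 - (b : ℝ) ^ 2) with hα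
  set β : ℕ → ℝ := fun b => -(b * rePart g) - imPart g * √(A ^ 2 - (b : ℝ) ^ 2) with hβ
  set G : ℝ → ℝ := fun t => 3 * E ^ 2
    + 12 * (∑ b ∈ Finset.Icc 1 n, saw (b * t + α b)) ^ 2
    + 12 * (∑ b ∈ Finset.Icc 1 n, saw (-(b * t) + β b)) ^ 2 with hG
  have hle : ∀ t, |remainder (proj (unip t * g)) T| ^ 2 ≤ G t := by
    intro t
    rw [sq_abs, hrem t hn hn', hG]
    refine le_trans (le_of_eq ?_) (sq_add_add_le _ _ _)
    congr 2
    · congr 2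
      refine Finset.sum_congr rfl fun b _ => ?_
      congr 1
      simp only [hα]
      ring
    · congr 1
      refine Finset.sum_congr rfl fun b _ => ?_
      congr 1
      simp only [hβ]
      ring
  have hi1 : IntervalIntegrable (fun t : ℝ => (∑ b ∈ Finset.Icc 1 n, saw (b * t + α b)) ^ 2)
      volume 0 1 := intervalIntegrable_sum_saw_sq n (fun b => b) α
  have hi2 : IntervalIntegrable (fun t : ℝ => (∑ b ∈ Finset.Icc 1 n, saw (-(b * t) + β b)) ^ 2)
      volume 0 1 := by
    simpa only [neg_mul] using intervalIntegrable_sum_saw_sq n (fun b => -(b : ℝ)) β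
  have hi3 : IntervalIntegrable (fun t : ℝ => 3 * E ^ 2
      + 12 * (∑ b ∈ Finset.Icc 1 n, saw (b * t + α b)) ^ 2) volume 0 1 :=
    intervalIntegrable_const.add (hi1.const_mul 12)
  have hGi : IntervalIntegrable G volume 0 1 := hi3.add (hi2.const_mul 12)
  calc ∫⁻ t in Set.Ioc (0 : ℝ) 1, ENNReal.ofReal (|remainder (proj (unip t * g)) T| ^ 2)
      ≤ ∫⁻ t in Set.Ioc (0 : ℝ) 1, ENNReal.ofReal (G t) :=
        lintegral_mono fun t => ENNReal.ofReal_le_ofReal (hle t)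
    _ = ENNReal.ofReal (∫ t in (0 : ℝ)..1, G t) := by
        rw [intervalIntegral.integral_of_le zero_le_one, ofReal_integral_eq_lintegral_ofReal
          ((intervalIntegrable_iff_integrableOn_Ioc_of_le zero_le_one).mp hGi)
          (Filter.Eventually.of_forall fun t => (sq_nonneg _).trans (hle t))]
    _ ≤ _ := by
        refine ENNReal.ofReal_le_ofReal ?_
        have h1 := integral_sum_saw_sq_le n α
        have h2 := integral_sum_saw_neg_sq_le n β
        rw [hG, intervalIntegral.integral_add hi3 (hi2.const_mul 12),
          intervalIntegral.integral_add intervalIntegrable_const (hi1.const_mul 12),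
          intervalIntegral.integral_const_mul (12 : ℝ),
          intervalIntegral.integral_const_mul (12 : ℝ),
          intervalIntegral.integral_const]
        simp only [sub_zero, smul_eq_mul, one_mul]
        linarith

/-- The mean square of the remainder over a closed horocycle, uniformly for bounded imaginary
part. -/
theorem exists_lintegral_remainder_unip_mul_sq_le (Y : ℝ) (hY : 0 < Y) :
    ∃ C : ℝ, 0 < C ∧ ∀ g : SL(2, ℝ), 1 / 4 ≤ imPart g → imPart g ≤ Y → ∀ T : ℝ, 2 ≤ T →
      ∫⁻ t in Set.Ioc (0 : ℝ) 1, ENNReal.ofReal (|remainder (proj (unip t * g)) T| ^ 2)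
        ≤ ENNReal.ofReal (C * (T * Real.log T ^ 2)) := by
  -- The first term is 3(28Y + 1)²T with T ≤ 4T log² T; the second is 6 times the factor 32 bounding
  -- the sawtooth part.
  refine ⟨12 * (28 * Y + 1) ^ 2 + 192, by positivity, fun g hg hgY T hT => ?_⟩
  have hy := imPart_pos g
  have hT0 : 0 < T := by linarith
  have hA0 : 0 < T / √(imPart g) := by positivity
  have hA2 : T / √(imPart g) ≤ 2 * T := by
    have h : 1 / 2 ≤ √(imPart g) := Real.le_sqrt_of_sq_le (by linarith)
    rw [div_le_iff₀ (by positivity)]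
    nlinarith
  have hlog2 : 1 / 2 ≤ Real.log T :=
    (by linarith [Real.log_two_gt_d9] : 1 / 2 ≤ Real.log 2).trans
      (Real.log_le_log (by norm_num) hT)
  -- Taking n = ⌈A⌉ − 1 rather than ⌊A⌋ keeps n < A strict even when A is an integer.
  obtain ⟨n, hn⟩ : ∃ n : ℕ, ⌈T / √(imPart g)⌉₊ = n + 1 :=
    Nat.exists_eq_succ_of_ne_zero (Nat.ceil_pos.mpr hA0).ne'
  have hn1 : (n : ℝ) < T / √(imPart g) := Nat.lt_ceil.mp (by omega)
  have hn2 : T / √(imPart g) ≤ n + 1 := by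
    have := Nat.le_ceil (T / √(imPart g))
    rw [hn] at this
    exact_mod_cast this
  refine (lintegral_remainder_unip_mul_sq_le g hT0 hn1 hn2).trans (ENNReal.ofReal_le_ofReal ?_)
  set A := T / √(imPart g)
  have hsT : 1 ≤ √T := Real.le_sqrt_of_sq_le (by linarith)
  have hsA : √A ≤ 2 * √T := by
    rw [Real.sqrt_le_left (by positivity), mul_pow, Real.sq_sqrt hT0.le]
    linarith
  have h1 : (2 * imPart g * (6 * √A + 2) + 1) ^ 2 ≤ (28 * Y + 1) ^ 2 * T := by
    refine le_of_le_of_eq ?_ (show ((28 * Y + 1) * √T) ^ 2 = _ by rw [mul_pow, Real.sq_sqrt hT0.le])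
    refine pow_le_pow_left₀ (by positivity) ?_ 2
    have h2 : 2 * imPart g * (6 * √A + 2) ≤ 2 * Y * (14 * √T) := by
      gcongr
      linarith
    linarith
  have h2 : T ≤ 4 * (T * Real.log T ^ 2) := by
    have : (1 / 2 : ℝ) ^ 2 ≤ Real.log T ^ 2 := pow_le_pow_left₀ (by norm_num) hlog2 2
    nlinarith
  have h3 : (n : ℝ) * (1 + Real.log n) ^ 2 ≤ 32 * (T * Real.log T ^ 2) := by
    have hlogn : Real.log n ≤ Real.log (2 * T) := by
      rcases n.eq_zero_or_pos with h0 | hpos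
      · rw [h0]
        simpa using Real.log_nonneg (by linarith : 1 ≤ 2 * T)
      · exact Real.log_le_log (by exact_mod_cast hpos) (by linarith)
    rw [Real.log_mul two_ne_zero hT0.ne'] at hlogn
    have hl2 : Real.log 2 ≤ Real.log T := Real.log_le_log (by norm_num) hT
    have hn0 : 0 ≤ Real.log n := Real.log_natCast_nonneg n
    calc (n : ℝ) * (1 + Real.log n) ^ 2 ≤ (2 * T) * (4 * Real.log T) ^ 2 := by
          gcongr
          · linarith
          · linarith
      _ = 32 * (T * Real.log T ^ 2) := by ring
  have h4 : (28 * Y + 1) ^ 2 * T ≤ (28 * Y + 1) ^ 2 * (4 * (T * Real.log T ^ 2)) := by gcongr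
  linarith

/-! ### Topology and measurability -/

instance instSecondCountableTopologySL2R : SecondCountableTopology SL(2, ℝ) :=
  have : SecondCountableTopology (Matrix (Fin 2) (Fin 2) ℝ) :=
    inferInstanceAs (SecondCountableTopology (Fin 2 → Fin 2 → ℝ))
  (SpecialLinearGroup.isClosedEmbedding_val (n := Fin 2)
    (R := ℝ)).isEmbedding.secondCountableTopology

theorem continuous_entry (i j : Fin 2) : Continuous fun g : SL(2, ℝ) => g i j :=
  (continuous_apply_apply i j).comp
    (SpecialLinearGroup.isClosedEmbedding_val (n := Fin 2) (R := ℝ)).continuous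

theorem continuous_imPart : Continuous imPart :=
  (((continuous_entry 1 0).pow 2).add ((continuous_entry 1 1).pow 2)).inv₀
    fun g => (bottom_sq_pos g).ne'

theorem continuous_rePart : Continuous rePart :=
  continuous_imPart.mul (((continuous_entry 0 0).mul (continuous_entry 1 0)).add
    ((continuous_entry 0 1).mul (continuous_entry 1 1)))

theorem continuous_unip : Continuous unip := by
  refine (SpecialLinearGroup.isClosedEmbedding_val (n := Fin 2)
    (R := ℝ)).isEmbedding.continuous_iff.mpr ?_
  refine continuous_matrix fun i j => ?_
  fin_cases i <;> fin_cases j <;> simp <;> fun_prop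

theorem continuous_proj : Continuous proj := continuous_quotient_mk'

theorem isOpenMap_proj : IsOpenMap proj := isOpenMap_quotient_mk'_mul (Γ := Gam)

theorem isQuotientMap_proj : Topology.IsQuotientMap proj := isQuotientMap_quotient_mk'

/-- Since the disc is open, the count is a sum over coordinate vectors m of indicators of open sets
of g. -/
theorem lowerSemicontinuous_count_proj {T : ℝ} (hT : 0 < T) :
    LowerSemicontinuous fun g : SL(2, ℝ) => (count (proj g) T : ENNReal) := by
  let S : (Fin 2 → ℤ) → Set SL(2, ℝ) := fun m => {g | m ∈ coordsLT g T}
  have hS : ∀ m, IsOpen (S m) := fun m => by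
    have hc : Continuous fun g : SL(2, ℝ) =>
        ‖(WithLp.toLp 2 ((fun i => (m i : ℝ)) ᵥ* (g : Matrix (Fin 2) (Fin 2) ℝ)) :
          EuclideanSpace ℝ (Fin 2))‖ := by
      refine continuous_norm.comp ((PiLp.continuous_toLp 2 _).comp (continuous_pi fun j => ?_))
      simp only [Matrix.vecMul, dotProduct]
      exact continuous_finsetSum _ fun i _ => continuous_const.mul (continuous_entry i j)
    exact isOpen_lt hc continuous_const
  have h : (fun g : SL(2, ℝ) => (count (proj g) T : ENNReal))
      = fun g => ∑' m, (S m).indicator (fun _ => 1) g := by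
    ext g
    have h1 : ∀ m, (S m).indicator (fun _ => (1 : ENNReal)) g
        = (coordsLT g T).indicator (fun _ => 1) m := fun m => rfl
    rw [tsum_congr h1, ← tsum_subtype, ENNReal.tsum_set_one, count_proj_eq_ncard,
      ← (finite_coordsLT g hT).cast_ncard_eq]
    rfl
  rw [h]
  exact lowerSemicontinuous_tsum fun m => (hS m).lowerSemicontinuous_indicator zero_le_one

theorem measurable_remainder {T : ℝ} (hT : 0 < T) : Measurable fun L => remainder L T := by
  have h : LowerSemicontinuous fun L => (count L T : ENNReal) := by
    rw [lowerSemicontinuous_iff_isOpen_preimage]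
    intro y
    rw [← isQuotientMap_proj.isOpen_preimage]
    exact (lowerSemicontinuous_count_proj hT).isOpen_preimage y
  have h2 : Measurable fun L => (count L T : ENNReal) := h.measurable
  have h3 : Measurable fun L => ((count L T : ENNReal)).toReal := h2.ennreal_toReal
  simp only [ENNReal.toReal_natCast] at h3
  exact h3.sub_const _

/-! ### The fundamental set and its Haar measure -/

theorem im_smul_I (g : SL(2, ℝ)) : (g • UpperHalfPlane.I).im = imPart g := by
  have h := UpperHalfPlane.coe_specialLinearGroup_apply g UpperHalfPlane.I
  have hd := det_eq_one g
  rw [← UpperHalfPlane.coe_im, h, Complex.div_im]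
  have hb := (bottom_sq_pos g).ne'
  simp [imPart, Complex.normSq_apply]
  rw [show g 1 1 * g 1 1 + g 1 0 * g 1 0 = g 1 0 ^ 2 + g 1 1 ^ 2 by ring]
  field_simp
  linear_combination hd

theorem re_smul_I (g : SL(2, ℝ)) : (g • UpperHalfPlane.I).re = rePart g := by
  have h := UpperHalfPlane.coe_specialLinearGroup_apply g UpperHalfPlane.I
  rw [← UpperHalfPlane.coe_re, h, Complex.div_re]
  have hb := (bottom_sq_pos g).ne'
  simp [imPart, rePart, Complex.normSq_apply]
  rw [show g 1 1 * g 1 1 + g 1 0 * g 1 0 = g 1 0 ^ 2 + g 1 1 ^ 2 by ring]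
  field_simp
  ring

theorem mem_fundamentalSet_iff (g : SL(2, ℝ)) :
    g ∈ fundamentalSet ↔ 1 ≤ rePart g ^ 2 + imPart g ^ 2 ∧ |rePart g| ≤ 1 / 2 := by
  change (1 ≤ Complex.normSq _ ∧ |UpperHalfPlane.re _| ≤ _) ↔ _
  rw [re_smul_I, Complex.normSq_apply, UpperHalfPlane.coe_re, UpperHalfPlane.coe_im, re_smul_I,
    im_smul_I, sq, sq]

theorem half_le_imPart_of_mem_fundamentalSet {g : SL(2, ℝ)} (hg : g ∈ fundamentalSet) :
    1 / 2 ≤ imPart g := by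
  obtain ⟨h1, h2⟩ := (mem_fundamentalSet_iff g).mp hg
  have h3 : rePart g ^ 2 ≤ (1 / 2) ^ 2 := sq_le_sq' (abs_le.mp h2).1 (abs_le.mp h2).2
  nlinarith [imPart_pos g]

/-- The set of `g` with `g • i` in a closed box. -/
def box (X a b : ℝ) : Set SL(2, ℝ) := {g | |rePart g| ≤ X ∧ a ≤ imPart g ∧ imPart g ≤ b}

theorem isClosed_box (X a b : ℝ) : IsClosed (box X a b) :=
  (isClosed_le continuous_rePart.abs continuous_const).inter
    ((isClosed_le continuous_const continuous_imPart).inter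
      (isClosed_le continuous_imPart continuous_const))

/-- The rows have squared lengths 1/y and (x² + y²)/y, so a lower bound on y together with bounds on
x and y bounds all entries. -/
theorem isCompact_box (X b : ℝ) {a : ℝ} (ha : 0 < a) : IsCompact (box X a b) := by
  set M := √((1 + X ^ 2 + b ^ 2) / a)
  have hK : IsCompact (Set.pi Set.univ fun _ : Fin 2 => Set.pi Set.univ fun _ : Fin 2 =>
      Set.Icc (-M) M) :=
    isCompact_univ_pi fun _ => isCompact_univ_pi fun _ => isCompact_Icc
  refine ((SpecialLinearGroup.isClosedEmbedding_val (n := Fin 2)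
    (R := ℝ)).isCompact_preimage hK).of_isClosed_subset (isClosed_box X a b) ?_
  intro (g : SL(2, ℝ)) ⟨h1, h2, h3⟩
  have hy := imPart_pos g
  have hbot := imPart_mul_bottom g
  have htop := imPart_mul_top g
  have hX : rePart g ^ 2 ≤ X ^ 2 := sq_le_sq' (by linarith [(abs_le.mp h1).1]) (abs_le.mp h1).2
  have hY : imPart g ^ 2 ≤ b ^ 2 := pow_le_pow_left₀ hy.le h3 2
  have key : ∀ i j, g i j ∈ Set.Icc (-M) M := by
    intro i j
    rw [Set.mem_Icc, ← abs_le]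
    refine Real.abs_le_sqrt ?_
    rw [le_div_iff₀ ha]
    have : g i j ^ 2 * a ≤ g i j ^ 2 * imPart g := mul_le_mul_of_nonneg_left h2 (sq_nonneg _)
    refine this.trans ?_
    have p00 := mul_nonneg hy.le (sq_nonneg (g 0 0))
    have p01 := mul_nonneg hy.le (sq_nonneg (g 0 1))
    have p10 := mul_nonneg hy.le (sq_nonneg (g 1 0))
    have p11 := mul_nonneg hy.le (sq_nonneg (g 1 1))
    have := sq_nonneg X
    have := sq_nonneg b
    fin_cases i <;> fin_cases j <;> simp only [Fin.zero_eta, Fin.mk_one] <;> nlinarith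
  exact fun i _ j _ => key i j

/-- The set of `g` with `g • i` in the half-open box `[0, w) × [a, b)`. -/
def strip (w a b : ℝ) : Set SL(2, ℝ) :=
  {g | (0 ≤ rePart g ∧ rePart g < w) ∧ a ≤ imPart g ∧ imPart g < b}

theorem measurableSet_strip (w a b : ℝ) : MeasurableSet (strip w a b) :=
  ((measurableSet_le measurable_const continuous_rePart.measurable).inter
    (measurableSet_lt continuous_rePart.measurable measurable_const)).inter
    ((measurableSet_le measurable_const continuous_imPart.measurable).inter
      (measurableSet_lt continuous_imPart.measurable measurable_const))

/-- The diagonal matrix acting on the upper half plane by multiplication by `l`. -/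
noncomputable def dilation (l : ℝ) (hl : 0 < l) : SL(2, ℝ) :=
  ⟨!![√l, 0; 0, (√l)⁻¹], by simp [Matrix.det_fin_two, (Real.sqrt_pos.mpr hl).ne']⟩

theorem dilation_mul_zero {l : ℝ} (hl : 0 < l) (g : SL(2, ℝ)) (j : Fin 2) :
    (dilation l hl * g) 0 j = √l * g 0 j := by
  change ((!![√l, 0; 0, (√l)⁻¹] : Matrix (Fin 2) (Fin 2) ℝ)
    * (g : Matrix (Fin 2) (Fin 2) ℝ)) 0 j = _
  simp [Matrix.mul_apply, Fin.sum_univ_two]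

theorem dilation_mul_one {l : ℝ} (hl : 0 < l) (g : SL(2, ℝ)) (j : Fin 2) :
    (dilation l hl * g) 1 j = (√l)⁻¹ * g 1 j := by
  change ((!![√l, 0; 0, (√l)⁻¹] : Matrix (Fin 2) (Fin 2) ℝ)
    * (g : Matrix (Fin 2) (Fin 2) ℝ)) 1 j = _
  simp [Matrix.mul_apply, Fin.sum_univ_two]

theorem imPart_dilation_mul {l : ℝ} (hl : 0 < l) (g : SL(2, ℝ)) :
    imPart (dilation l hl * g) = l * imPart g := by
  simp only [imPart, dilation_mul_one, mul_pow, inv_pow, Real.sq_sqrt hl.le, ← mul_add, mul_inv,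
    inv_inv]

theorem rePart_dilation_mul {l : ℝ} (hl : 0 < l) (g : SL(2, ℝ)) :
    rePart (dilation l hl * g) = l * rePart g := by
  have h : √l ≠ 0 := (Real.sqrt_pos.mpr hl).ne'
  simp only [rePart, imPart_dilation_mul, dilation_mul_zero, dilation_mul_one]
  field_simp

/-- The strip and its unipotent translate by w are disjoint, of equal measure, and lie in the strip
of double width. -/
theorem two_mul_measure_strip_le (μ : Measure SL(2, ℝ)) [μ.IsMulLeftInvariant]
    (w a b : ℝ) :
    2 * μ (strip w a b) ≤ μ (strip (2 * w) a b) := by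
  rw [two_mul]
  nth_rewrite 2 [← measure_preimage_mul μ (unip (-w))]
  have hm : MeasurableSet ((fun h => unip (-w) * h) ⁻¹' strip w a b) :=
    (measurable_const_mul _) (measurableSet_strip w a b)
  rw [← measure_union _ hm]
  · refine measure_mono ?_
    rintro g (⟨⟨h1, h2⟩, h3, h4⟩ | ⟨⟨h1, h2⟩, h3, h4⟩)
    · exact ⟨⟨h1, by linarith⟩, h3, h4⟩
    · rw [rePart_unip_mul] at h1 h2
      rw [imPart_unip_mul] at h3 h4
      exact ⟨⟨by linarith, by linarith⟩, h3, h4⟩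
  · rw [Set.disjoint_left]
    rintro g ⟨⟨-, h2⟩, -⟩ ⟨⟨h1, -⟩, -⟩
    rw [rePart_unip_mul] at h1
    linarith

theorem measure_strip_div_two_pow_le (μ : Measure SL(2, ℝ)) [μ.IsMulLeftInvariant]
    (w a b : ℝ) (k : ℕ) :
    μ (strip (w / 2 ^ k) a b) ≤ (2 : ENNReal)⁻¹ ^ k * μ (strip w a b) := by
  induction k with
  | zero => simp
  | succ k ih =>
    have h := two_mul_measure_strip_le μ (w / 2 ^ (k + 1)) a b
    rw [show 2 * (w / 2 ^ (k + 1)) = w / 2 ^ k by rw [pow_succ]; field_simp] at h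
    calc μ (strip (w / 2 ^ (k + 1)) a b)
        = (2 : ENNReal)⁻¹ * (2 * μ (strip (w / 2 ^ (k + 1)) a b)) := by
          rw [← mul_assoc, ENNReal.inv_mul_cancel two_ne_zero ENNReal.ofNat_ne_top, one_mul]
      _ ≤ (2 : ENNReal)⁻¹ * ((2 : ENNReal)⁻¹ ^ k * μ (strip w a b)) := by
          exact mul_le_mul_right (h.trans ih) _
      _ = _ := by rw [pow_succ']; ring

theorem measure_strip_mul (μ : Measure SL(2, ℝ)) [μ.IsMulLeftInvariant]
    {l : ℝ} (hl : 0 < l) (w a b : ℝ) :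
    μ (strip w (l * a) (l * b)) = μ (strip (w / l) a b) := by
  rw [← measure_preimage_mul μ (dilation l hl) (strip w (l * a) (l * b))]
  congr 1
  ext g
  simp only [strip, Set.mem_preimage, Set.mem_ofPred_eq, rePart_dilation_mul, imPart_dilation_mul]
  rw [lt_div_iff₀' hl, mul_nonneg_iff_of_pos_left hl, mul_le_mul_iff_right₀ hl,
    mul_lt_mul_iff_right₀ hl]

theorem measure_strip_lt_top (μ : Measure SL(2, ℝ))
    [IsFiniteMeasureOnCompacts μ] (w b : ℝ) {a : ℝ} (ha : 0 < a) :
    μ (strip w a b) < ⊤ := by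
  refine (measure_mono ?_).trans_lt (isCompact_box w b ha).measure_lt_top
  rintro g ⟨⟨h1, h2⟩, h3, h4⟩
  exact ⟨abs_le.mpr ⟨by linarith, h2.le⟩, h3, h4.le⟩

/-- Dilation carries the dyadic layer of height 2^k to a fixed height and shrinks its width by 2^k,
so its measure is at most 2^(−k) times that of one fixed strip; the layers form a geometric series.
-/
theorem measure_fundamentalSet_lt_top (μ : Measure SL(2, ℝ)) [μ.IsMulLeftInvariant]
    [IsFiniteMeasureOnCompacts μ] : μ fundamentalSet < ⊤ := by
  -- The shift by 1/2 moves |x| ≤ 1/2 to [0, 1]; width 2 leaves room for the closed right end.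
  have hsub : fundamentalSet ⊆ ⋃ k : ℕ, (fun h => unip (1 / 2) * h) ⁻¹'
      strip 2 (2 ^ k * (1 / 2)) (2 ^ k * 1) := by
    intro g hg
    have hre := abs_le.mp ((mem_fundamentalSet_iff g).mp hg).2
    have him := half_le_imPart_of_mem_fundamentalSet hg
    obtain ⟨k, hk1, hk2⟩ := exists_nat_pow_near (x := 2 * imPart g) (y := 2)
      (by linarith) one_lt_two
    rw [pow_succ] at hk2
    refine Set.mem_iUnion.mpr ⟨k, ⟨?_, ?_⟩, ?_, ?_⟩
    · rw [rePart_unip_mul]; linarith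
    · rw [rePart_unip_mul]; linarith
    · rw [imPart_unip_mul]; linarith
    · rw [imPart_unip_mul]; linarith
  calc μ fundamentalSet
      ≤ ∑' k : ℕ, μ ((fun h => unip (1 / 2) * h) ⁻¹'
          strip 2 (2 ^ k * (1 / 2)) (2 ^ k * 1)) := (measure_mono hsub).trans (measure_iUnion_le _)
    _ ≤ ∑' k : ℕ, (2 : ENNReal)⁻¹ ^ k * μ (strip 2 (1 / 2) 1) := by
        refine ENNReal.tsum_le_tsum fun k => ?_
        rw [measure_preimage_mul, measure_strip_mul μ (by positivity)]
        exact measure_strip_div_two_pow_le μ _ _ _ k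
    _ = 2 * μ (strip 2 (1 / 2) 1) := by
        rw [ENNReal.tsum_mul_right, ENNReal.tsum_geometric, ENNReal.one_sub_inv_two, inv_inv]
    _ < ⊤ := ENNReal.mul_lt_top ENNReal.ofNat_lt_top
        (measure_strip_lt_top μ 2 1 (by norm_num))

theorem measure_fundamentalSet_pos (μ : Measure SL(2, ℝ))
    [μ.IsOpenPosMeasure] : 0 < μ fundamentalSet := by
  have hopen : IsOpen {g : SL(2, ℝ) | 1 < rePart g ^ 2 + imPart g ^ 2 ∧ |rePart g| < 1 / 2} :=
    (isOpen_lt continuous_const ((continuous_rePart.pow 2).add (continuous_imPart.pow 2))).inter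
      (isOpen_lt continuous_rePart.abs continuous_const)
  refine (hopen.measure_pos μ ⟨dilation 2 two_pos * 1, ?_⟩).trans_le (measure_mono ?_)
  · have h1 : imPart 1 = 1 := by simp [imPart]
    have h2 : rePart 1 = 0 := by simp [rePart]
    simp only [Set.mem_ofPred_eq, imPart_dilation_mul, rePart_dilation_mul, h1, h2]
    norm_num
  · rintro g ⟨h1, h2⟩
    exact (mem_fundamentalSet_iff g).mpr ⟨h1.le, h2.le⟩

/-! ### From horocycles to compact sets of lattices -/

/-- An integral over a box is bounded by the supremum of the averages along unit horocycle
segments. -/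
theorem setLIntegral_box_le_of_lintegral_unip_mul_le (μ : Measure SL(2, ℝ)) [μ.IsMulLeftInvariant]
    [SFinite μ] {F : SL(2, ℝ) → ENNReal}
    (hF : Measurable F) (X a b : ℝ) {M : ENNReal}
    (hM : ∀ g ∈ box (X + 1) a b, ∫⁻ t in Set.Ioc (0 : ℝ) 1, F (unip t * g) ≤ M) :
    ∫⁻ g in box X a b, F g ∂μ ≤ M * μ (box (X + 1) a b) := by
  have hX := (isClosed_box X a b).measurableSet
  have hX1 := (isClosed_box (X + 1) a b).measurableSet
  -- Left invariance moves the box by t ≤ 1, which the enlargement of X to X + 1 absorbs. Averaging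
  -- over t and exchanging integrals then finishes.
  have hshift : ∀ t ∈ Set.Ioc (0 : ℝ) 1, ∫⁻ g in box X a b, F g ∂μ
      ≤ ∫⁻ g in box (X + 1) a b, F (unip t * g) ∂μ := by
    intro t ht
    rw [← lintegral_indicator hX, ← lintegral_indicator hX1,
      ← lintegral_mul_left_eq_self _ (unip t)]
    refine lintegral_mono fun g => ?_
    by_cases hg : unip t * g ∈ box X a b
    · have hg1 : g ∈ box (X + 1) a b := by
        obtain ⟨h1, h2, h3⟩ := hg
        rw [rePart_unip_mul, abs_le] at h1
        rw [imPart_unip_mul] at h2 h3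
        exact ⟨abs_le.mpr ⟨by linarith [ht.1, ht.2], by linarith [ht.1, ht.2]⟩, h2, h3⟩
      rw [Set.indicator_of_mem hg, Set.indicator_of_mem hg1]
    · rw [Set.indicator_of_notMem hg]
      exact zero_le
  have hmeas : Measurable (Function.uncurry fun (t : ℝ) (g : SL(2, ℝ)) => F (unip t * g)) :=
    hF.comp ((continuous_unip.comp continuous_fst).mul continuous_snd).measurable
  calc ∫⁻ g in box X a b, F g ∂μ
      = ∫⁻ _ in Set.Ioc (0 : ℝ) 1, ∫⁻ g in box X a b, F g ∂μ := by simp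
    _ ≤ ∫⁻ t in Set.Ioc (0 : ℝ) 1, ∫⁻ g in box (X + 1) a b, F (unip t * g) ∂μ :=
        setLIntegral_mono' measurableSet_Ioc hshift
    _ = ∫⁻ g in box (X + 1) a b, (∫⁻ t in Set.Ioc (0 : ℝ) 1, F (unip t * g)) ∂μ :=
        lintegral_lintegral_swap hmeas.aemeasurable
    _ ≤ ∫⁻ _ in box (X + 1) a b, M ∂μ := setLIntegral_mono' hX1 hM
    _ = M * μ (box (X + 1) a b) := setLIntegral_const _ _

/-- With lower row (c, d) of the connecting integer matrix, Im g / Im k = |cz + d|². If c = 0 the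
heights agree; otherwise |cz + d|² ≥ (Im g)², so Im g ≤ 1/Im k < N. -/
theorem imPart_lt_of_proj_eq {g k : SL(2, ℝ)} (h : proj k = proj g)
    {N : ℝ} (hk : N⁻¹ < imPart k) (hk' : imPart k < N) : imPart g < N := by
  have hN : 0 < N := (imPart_pos k).trans hk'
  obtain ⟨γ, hγ⟩ := QuotientGroup.rightRel_apply.mp (Quotient.exact h)
  have hgk : k = SpecialLinearGroup.map (Int.castRingHom ℝ) γ⁻¹ * g := by
    rw [map_inv, hγ]
    group
  set δ := γ⁻¹
  have hrow : ∀ j, k 1 j = δ 1 0 * g 0 j + δ 1 1 * g 1 j := by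
    intro j
    have := congrArg (fun m : SL(2, ℝ) => m 1 j) hgk
    simpa [Matrix.mul_apply, Fin.sum_univ_two] using this
  have hy := imPart_pos g
  have h1 := imPart_mul_bottom g
  have h2 := imPart_mul_top g
  have h3 : rePart g = imPart g * (g 0 0 * g 1 0 + g 0 1 * g 1 1) := rfl
  have hinv : imPart g * (imPart k)⁻¹
      = (δ 1 1 + δ 1 0 * rePart g) ^ 2 + (δ 1 0 * imPart g) ^ 2 := by
    rw [show (imPart k)⁻¹ = k 1 0 ^ 2 + k 1 1 ^ 2 from inv_inv _, hrow, hrow]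
    linear_combination (δ 1 1 : ℝ) ^ 2 * h1 + (δ 1 0 : ℝ) ^ 2 * h2 - 2 * δ 1 0 * δ 1 1 * h3
  have hkN : (imPart k)⁻¹ < N := inv_lt_of_inv_lt₀ hN hk
  have hdet : δ 0 0 * δ 1 1 - δ 0 1 * δ 1 0 = 1 := by
    rw [← Matrix.det_fin_two]
    exact δ.det_coe
  by_cases h0 : δ 1 0 = 0
  · have hsq : (δ 1 1 : ℤ) ^ 2 = 1 := by
      rw [h0, mul_zero, sub_zero] at hdet
      exact Int.isUnit_sq (IsUnit.of_mul_eq_one_right _ hdet)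
    have hsq' : (δ 1 1 : ℝ) ^ 2 = 1 := by exact_mod_cast hsq
    rw [h0] at hinv
    simp only [Int.cast_zero, zero_mul, add_zero, hsq'] at hinv
    have : imPart g = imPart k := by
      have hk0 := (imPart_pos k).ne'
      field_simp at hinv
      linarith
    rwa [this]
  · have hone : (1 : ℝ) ≤ (δ 1 0 : ℝ) ^ 2 := by
      have : (1 : ℤ) ≤ (δ 1 0) ^ 2 := by
        have := sq_pos_of_ne_zero h0
        omega
      exact_mod_cast this
    have h4 : imPart g * imPart g ≤ imPart g * (imPart k)⁻¹ := by
      rw [hinv, mul_pow]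
      nlinarith [sq_nonneg ((δ 1 1 : ℝ) + δ 1 0 * rePart g), sq_nonneg (imPart g)]
    exact (le_of_mul_le_mul_left h4 hy).trans_lt hkN

/-- A compact set of lattices lies in an open set over which the fundamental set is bounded. -/
theorem exists_isOpen_superset_of_isCompact {K : Set LatticeSpace} (hK : IsCompact K) :
    ∃ U, IsOpen U ∧ K ⊆ U ∧ ∃ Y : ℝ, 0 < Y ∧
      proj ⁻¹' U ∩ fundamentalSet ⊆ box (1 / 2) (1 / 4) Y := by
  -- These open sets increase to the whole group, so by compactness the image of a single one covers
  -- K.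
  let V : ℕ → Set SL(2, ℝ) := fun n => {g | ((n : ℝ) + 1)⁻¹ < imPart g ∧ imPart g < n + 1}
  have hV : ∀ n, IsOpen (V n) := fun n =>
    (isOpen_lt continuous_const continuous_imPart).inter
      (isOpen_lt continuous_imPart continuous_const)
  have hmono : Monotone V := by
    rintro m n hmn g ⟨h1, h2⟩
    have h : (m : ℝ) + 1 ≤ n + 1 := by
      have : (m : ℝ) ≤ n := by exact_mod_cast hmn
      linarith
    exact ⟨(inv_anti₀ (by positivity) h).trans_lt h1, h2.trans_le h⟩
  have hcover : K ⊆ ⋃ n, proj '' V n := by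
    intro L _
    obtain ⟨g, rfl⟩ := Quotient.exists_rep L
    obtain ⟨n, hn⟩ := exists_nat_gt (max (imPart g) (imPart g)⁻¹)
    have h1 := (le_max_left _ _).trans_lt hn
    have h2 := (le_max_right _ _).trans_lt hn
    exact Set.mem_iUnion.mpr ⟨n, g, ⟨inv_lt_of_inv_lt₀ (imPart_pos g) (by linarith), by linarith⟩,
      rfl⟩
  obtain ⟨n, hn⟩ := hK.elim_directed_cover _ (fun n => isOpenMap_proj _ (hV n)) hcover
    (Monotone.directed_le fun m n hmn => Set.image_mono (hmono hmn))
  refine ⟨_, isOpenMap_proj _ (hV n), hn, n + 1, by positivity, ?_⟩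
  rintro g ⟨⟨k, ⟨hk1, hk2⟩, hkg⟩, hg⟩
  have him := half_le_imPart_of_mem_fundamentalSet hg
  exact ⟨((mem_fundamentalSet_iff g).mp hg).2, by linarith,
    (imPart_lt_of_proj_eq hkg hk1 hk2).le⟩

/-! ### The final estimate -/

theorem isProbabilityMeasure_haarProb : IsProbabilityMeasure haarProb := by
  have h : IsProbabilityMeasure ((Measure.haar fundamentalSet)⁻¹ •
      (Measure.haar : Measure SL(2, ℝ)).restrict fundamentalSet) := by
    constructor
    rw [Measure.smul_apply, Measure.restrict_apply_univ, smul_eq_mul]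
    exact ENNReal.inv_mul_cancel (measure_fundamentalSet_pos _).ne'
      (measure_fundamentalSet_lt_top _).ne
  exact Measure.isProbabilityMeasure_map continuous_proj.measurable.aemeasurable

theorem exists_setLIntegral_remainder_sq_le {K : Set LatticeSpace} (hK : IsCompact K) :
    ∃ C : ℝ, 0 < C ∧ ∀ T : ℝ, 2 ≤ T →
      ∫⁻ L in K, ENNReal.ofReal (|remainder L T| ^ 2) ∂haarProb
        ≤ ENNReal.ofReal (C * (T * Real.log T ^ 2)) := by
  obtain ⟨U, hU, hKU, Y, hY, hbox⟩ := exists_isOpen_superset_of_isCompact hK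
  obtain ⟨C, hC, hCT⟩ := exists_lintegral_remainder_unip_mul_sq_le Y hY
  set ν : Measure SL(2, ℝ) := Measure.haar with hν
  set c : ENNReal := (ν fundamentalSet)⁻¹ * ν (box (1 / 2 + 1) (1 / 4) Y) with hc
  have hctop : c ≠ ⊤ := ENNReal.mul_ne_top
    (ENNReal.inv_ne_top.mpr (measure_fundamentalSet_pos ν).ne')
    (isCompact_box _ _ (by norm_num)).measure_lt_top.ne
  -- Adding 1 makes the constant positive without showing that the box has positive measure.
  refine ⟨(c.toReal + 1) * C, by positivity, fun T hT => ?_⟩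
  have hT0 : 0 < T := by linarith
  have hmeas : Measurable fun L => ENNReal.ofReal (|remainder L T| ^ 2) :=
    ((measurable_remainder hT0).abs.pow_const 2).ennreal_ofReal
  have hproj := continuous_proj.measurable
  have hUm : MeasurableSet (proj ⁻¹' U) := hproj hU.measurableSet
  have hbnd := setLIntegral_box_le_of_lintegral_unip_mul_le ν (hmeas.comp hproj) (1 / 2) (1 / 4) Y
    (M := ENNReal.ofReal (C * (T * Real.log T ^ 2))) fun g hg => hCT g hg.2.1 hg.2.2 T hT
  -- Enlarging K to the open set U secures measurability for the pushforward formula, with no need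
  -- to know that K is measurable.
  calc ∫⁻ L in K, ENNReal.ofReal (|remainder L T| ^ 2) ∂haarProb
      ≤ ∫⁻ L in U, ENNReal.ofReal (|remainder L T| ^ 2) ∂haarProb := lintegral_mono_set hKU
    _ = (ν fundamentalSet)⁻¹ * ∫⁻ g in proj ⁻¹' U ∩ fundamentalSet,
          ENNReal.ofReal (|remainder (proj g) T| ^ 2) ∂ν := by
        rw [haarProb, setLIntegral_map hU.measurableSet hmeas hproj, Measure.restrict_smul,
          lintegral_smul_measure, Measure.restrict_restrict hUm, smul_eq_mul]
    _ ≤ (ν fundamentalSet)⁻¹ * (ENNReal.ofReal (C * (T * Real.log T ^ 2))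
          * ν (box (1 / 2 + 1) (1 / 4) Y)) := by
        gcongr
        exact (lintegral_mono_set hbox).trans hbnd
    _ = c * ENNReal.ofReal (C * (T * Real.log T ^ 2)) := by rw [hc]; ring
    _ = ENNReal.ofReal (c.toReal * (C * (T * Real.log T ^ 2))) := by
        rw [ENNReal.ofReal_mul ENNReal.toReal_nonneg, ENNReal.ofReal_toReal hctop]
    _ ≤ ENNReal.ofReal ((c.toReal + 1) * C * (T * Real.log T ^ 2)) := by
        refine ENNReal.ofReal_le_ofReal ?_
        have : 0 ≤ C * (T * Real.log T ^ 2) := by positivity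
        linarith

end UnimodularLattice

theorem mainTheorem2 :
    IsProbabilityMeasure UnimodularLattice.haarProb ∧
    ∀ K : Set UnimodularLattice.LatticeSpace, IsCompact K →
      ∃ C : ℝ, 0 < C ∧ ∀ T : ℝ, 2 ≤ T →
        IntegrableOn (fun L => |UnimodularLattice.remainder L T| ^ 2) K
          UnimodularLattice.haarProb ∧
        ∫ L in K, |UnimodularLattice.remainder L T| ^ 2 ∂UnimodularLattice.haarProb
          ≤ C * (T * Real.log T ^ 2) := by
  refine ⟨UnimodularLattice.isProbabilityMeasure_haarProb, fun K hK => ?_⟩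
  obtain ⟨C, hC, hCT⟩ := UnimodularLattice.exists_setLIntegral_remainder_sq_le hK
  refine ⟨C, hC, fun T hT => ?_⟩
  have hT0 : 0 < T := by linarith
  have hmeas : AEStronglyMeasurable (fun L => |UnimodularLattice.remainder L T| ^ 2)
      (UnimodularLattice.haarProb.restrict K) :=
    ((UnimodularLattice.measurable_remainder hT0).abs.pow_const 2).aestronglyMeasurable
  have hnn : 0 ≤ᵐ[UnimodularLattice.haarProb.restrict K]
      fun L => |UnimodularLattice.remainder L T| ^ 2 :=
    Filter.Eventually.of_forall fun L => sq_nonneg _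
  refine ⟨⟨hmeas, ?_⟩, ?_⟩
  · rw [hasFiniteIntegral_iff_ofReal hnn]
    exact (hCT T hT).trans_lt ENNReal.ofReal_lt_top
  · rw [integral_eq_lintegral_of_nonneg_ae hnn hmeas]
    exact ENNReal.toReal_le_of_le_ofReal (by positivity) (hCT T hT)
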